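/- Let $n\ge 2$ and let $f,g\in\mathbb C[z_1,\dots,z_n]$ be weighted homogeneous polynomials with weights $w_f=(w_1,\dots,w_n)$ and $w_g=s\,w_f$, where the $w_j$ and $s$ are positive rational numbers; that is, $$\sum_{j=1}^n\frac{z_j}{w_j}\frac{\partial f}{\partial z_j}=f,\qquad \sum_{j=1}^n\frac{z_j}{s\,w_j}\frac{\partial g}{\partial z_j}=g .$$ Let $\varepsilon>0$, $S_\varepsilon=\{z\in\mathbb C^n : \|z\|=\varepsilon\}$, $K_{fg}=\{z\in S_\varepsilon : f(z)g(z)=0\}$, and let $$\Phi:S_\varepsilon\setminus K_{fg}\to T^2=S^1\times S^1,\qquad \Phi(z)=\left(\frac{f(z)}{|f(z)|},\frac{g(z)}{|g(z)|}\right)$$ be the Milnor fibration product map associated with $f$ and $g$. Write $\langle u,v\rangle=\sum_j u_j\overline{v_j}$. For a holomorphic function $h$ near $p\in\mathbb C^n$ put $\operatorname{grad}h(p)=\left(\overline{\frac{\partial h}{\partial z_1}(p)},\dots,\overline{\frac{\partial h}{\partial z_n}(p)}\right)$ and $\operatorname{Hess}_p(h)=\left(\frac{\partial^2 h}{\partial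 z_j\partial z_k}(p)\right)_{j,k}$; below, $\log f$ and $\log g$ denote arbitrary holomorphic branches of the logarithms near $p$. Let $p\in S_\varepsilon\setminus K_{fg}$ be a singular point of $\Phi$ (that is, $\operatorname{rank}d\Phi_p<2$) such that $p$ and $i\operatorname{grad}\log f(p)$ are linearly dependent over $\mathbb C$. Let $W$ be an $n\times(n-1)$ complex matrix whose columns form a complex basis of the $(n-1)$-dimensional complex vector space $\{v\in\mathbb C^n : \langle v,p\rangle=0\}$. Then $p$ is a fold point of $\Phi$ if and only if $$\det\left(W^T\operatorname{Hess}_p\bigl(-i(\log g-s\log f)\bigr)W\right)\neq 0 .$$ Here $p$ is a fold point of $\Phi$ if there are smooth local coordinates $(t,x_1,\dots,x_{2n-2})$ of $S_\varepsilon\setminus K_{fg}$ centred at $p$ and smooth local coordinates of $T^2$ centred at $\Phi(p)$ in which $\Phi$ takes the form $(t,x_1,\dots,x_{2n-2})\mapsto(t,\pm x_1^2\pm\cdots\pm x_{2n-2}^2)$ for some choice of signs. -/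

import Mathlib

open scoped ContDiff Topology

noncomputable section

namespace MilnorProduct

section Submanifolds

variable {H E F : Type*}
  [NormedAddCommGroup H] [NormedSpace ℝ H]
  [NormedAddCommGroup E] [NormedSpace ℝ E]
  [NormedAddCommGroup F] [NormedSpace ℝ F]

/-- `φ` is a smooth local parametrization of the embedded submanifold `M ⊆ E`, modelled on `H`:
a homeomorphism from an open subset of `H` onto an open subset of `M` (this is the type of `φ`)
which is a smooth immersion as a map into `E`. Its inverse is a local coordinate system of `M`. -/
structure IsLocalParam {M : Set E} (φ : OpenPartialHomeomorph H M) : Prop where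
  contDiffOn : ContDiffOn ℝ ∞ (fun x => (φ x : E)) φ.source
  immersion : ∀ x ∈ φ.source, Function.Injective (fderiv ℝ (fun y => (φ y : E)) x)

/-- `p` is a singular point of the smooth map `Φ : M → N` from a submanifold `M` of dimension
`k + 1` to a surface `N`: in local coordinates of `M` at `p`, the differential of `Φ` at `p` has
rank less than two. (By the chain rule this does not depend on the coordinates.) -/
def IsSingularPoint (k : ℕ) {M : Set E} {N : Set F} (Φ : M → N) (p : M) : Prop :=
  ∃ φ : OpenPartialHomeomorph (ℝ × (Fin k → ℝ)) M, IsLocalParam φ ∧ p ∈ φ.target ∧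
    Module.finrank ℝ
      (LinearMap.range (fderiv ℝ (fun x => (Φ (φ x) : F)) (φ.symm p)).toLinearMap) < 2

/-- `p` is a fold point of the map `Φ : M → N` from a submanifold `M` of dimension `k + 1` to a
surface `N`: there are smooth local coordinates `(t, x₁, …, x_k)` of `M` centred at `p` and
smooth local coordinates of `N` centred at `Φ p` in which `Φ` has the form
`(t, x₁, …, x_k) ↦ (t, ± x₁ ^ 2 ± ⋯ ± x_k ^ 2)`. -/
def IsFoldPoint (k : ℕ) {M : Set E} {N : Set F} (Φ : M → N) (p : M) : Prop :=
  ∃ (φ : OpenPartialHomeomorph (ℝ × (Fin k → ℝ)) M) (ψ : OpenPartialHomeomorph (ℝ × ℝ) N)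
    (σ : Fin k → ℝ),
    IsLocalParam φ ∧ IsLocalParam ψ ∧ (∀ i, σ i = 1 ∨ σ i = -1) ∧
    0 ∈ φ.source ∧ φ 0 = p ∧ 0 ∈ ψ.source ∧ ψ 0 = Φ p ∧
    ∀ x ∈ φ.source, (x.1, ∑ i, σ i * x.2 i ^ 2) ∈ ψ.source ∧
      Φ (φ x) = ψ (x.1, ∑ i, σ i * x.2 i ^ 2)

end Submanifolds

section Milnor

variable {n : ℕ}

/-- The value of the polynomial `f` at a point of `ℂⁿ`. -/
def polyVal (f : MvPolynomial (Fin n) ℂ) (z : EuclideanSpace ℂ (Fin n)) : ℂ :=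
  MvPolynomial.eval (fun j => z j) f

/-- The link `K_h = {z ∈ S_ε | h(z) = 0}`. -/
def link (h : MvPolynomial (Fin n) ℂ) (ε : ℝ) : Set (EuclideanSpace ℂ (Fin n)) :=
  {z | z ∈ Metric.sphere 0 ε ∧ polyVal h z = 0}

/-- `S_ε ∖ K_{fg}`. -/
def source (f g : MvPolynomial (Fin n) ℂ) (ε : ℝ) : Set (EuclideanSpace ℂ (Fin n)) :=
  Metric.sphere 0 ε \ link (f * g) ε

/-- The torus `T² = S¹ × S¹`. -/
def torus : Set (ℂ × ℂ) := Metric.sphere 0 1 ×ˢ Metric.sphere 0 1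

theorem polyVal_ne_zero {f g : MvPolynomial (Fin n) ℂ} {ε : ℝ} (z : source f g ε) :
    polyVal f z ≠ 0 ∧ polyVal g z ≠ 0 := by
  obtain ⟨z, hz, hk⟩ := z
  have h : polyVal (f * g) z ≠ 0 := fun h => hk ⟨hz, h⟩
  simpa [polyVal, not_or] using h

/-- The Milnor fibration product map `z ↦ (f(z)/|f(z)|, g(z)/|g(z)|)`. -/
def productMap (f g : MvPolynomial (Fin n) ℂ) (ε : ℝ) (z : source f g ε) : torus :=
  ⟨(polyVal f z / ‖polyVal f z‖, polyVal g z / ‖polyVal g z‖), by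
    have h := polyVal_ne_zero z
    simp [torus, h.1, h.2]⟩

/-- `f` is weighted homogeneous with weights `w`: the `w_j` are positive rational numbers and
`∑ (z_j / w_j) ∂f/∂z_j = f`. -/
structure HasWeights (f : MvPolynomial (Fin n) ℂ) (w : Fin n → ℚ) : Prop where
  pos : ∀ j, 0 < w j
  euler : ∑ j, MvPolynomial.C (1 / (w j : ℂ)) * MvPolynomial.X j * MvPolynomial.pderiv j f = f

/-- `l` is a holomorphic branch of `log f` near `p`. -/
structure IsLogBranch (f : MvPolynomial (Fin n) ℂ) (p : EuclideanSpace ℂ (Fin n))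
    (l : EuclideanSpace ℂ (Fin n) → ℂ) : Prop where
  analyticAt : AnalyticAt ℂ l p
  exp_eq : ∀ᶠ z in 𝓝 p, Complex.exp (l z) = polyVal f z

/-- The complex partial derivative `∂h/∂z_j`. -/
def partialDeriv (j : Fin n) (h : EuclideanSpace ℂ (Fin n) → ℂ) :
    EuclideanSpace ℂ (Fin n) → ℂ :=
  fun z => fderiv ℂ h z (EuclideanSpace.single j 1)

/-- The gradient of a holomorphic function, `grad h = (conj ∂h/∂z₁, …, conj ∂h/∂z_n)`. -/
def grad (h : EuclideanSpace ℂ (Fin n) → ℂ) (p : EuclideanSpace ℂ (Fin n)) :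
    EuclideanSpace ℂ (Fin n) :=
  WithLp.toLp 2 fun j => (starRingEnd ℂ) (partialDeriv j h p)

/-- The complex Hessian matrix `(∂²h/∂z_j∂z_k (p))`. -/
def hess (h : EuclideanSpace ℂ (Fin n) → ℂ) (p : EuclideanSpace ℂ (Fin n)) :
    Matrix (Fin n) (Fin n) ℂ :=
  Matrix.of fun j k => partialDeriv j (partialDeriv k h) p

end Milnor

end MilnorProduct

end

/-!
Let `h = -i (log g - s log f)`, a holomorphic function near `p` with `Re h = arg g - s arg f`
(`shearedLog`). By weighted homogeneity the group `z ↦ (exp (ζ / w_j) z_j)` (`weightedFlow`) adds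
`ζ` to `log f` and `s ζ` to `log g`, so it leaves `h` unchanged, and for imaginary `ζ` it preserves
the sphere. In the coordinates `(arg f, arg g - s arg f)` of the torus (`torusAngles`), the map `Φ`
is `(arg f, Re h)`.

The velocity of the group at `p` (`weightedEuler`) has positive real inner product with `p`. Hence
`p` is singular for `Φ` only if `p` is a critical point of `h` on `ℂⁿ`
(`fderiv_shearedLog_eq_zero`), and the dependence of `p` and `i grad log f (p)` makes `d (log f)_p`
a real multiple of `⟨·, p⟩` (`exists_inner_eq_mul_fderiv`). So the kernel of `d (arg f)_p` on the
tangent space of the sphere is the complex hyperplane `{v | ⟨v, p⟩ = 0}`, and what matters is the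
restriction to it of the quadratic form `v ↦ Re (vᵀ Hess h v)`. As the form is the real part of a
complex one, it is nondegenerate exactly when the Gram determinant of the complex Hessian on a basis
is nonzero (`det_ne_zero_iff_re_nondegenerate`).

* A fold has nondegenerate Hessian (`nondegenerate_of_isFoldPoint`): since `dh_p = 0`, the
  second-order part of `h` along a curve depends only on its velocity
  (`tendsto_div_sq_of_critical`), and along the lines `x ↦ (0, t x)` of a fold chart it is a nonzero
  multiple of `∑ σᵢ xᵢ²`.
* Conversely (`isFoldPoint_of_nondegenerate`), project the affine space `p + {v | ⟨v, p⟩ = 0}`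
  radially to the sphere, take Morse coordinates for `Re h` on this slice (`exists_morse_chart`),
  and move the slice by the circle action, parametrized so that `arg f` becomes the coordinate `t`.
  Because `Re h` is invariant, no Morse lemma with parameters is needed.

The Morse lemma follows from Hadamard's lemma (`exists_contDiff_clm_apply_self`), applied twice, and
from the smooth square root of matrices near the identity (`exists_matrix_sqrt`).
-/

noncomputable section

namespace MilnorProduct

/-! ### The inverse function theorem on open sets -/

section LocalDiffeomorphisms

variable {E F : Type*} [NormedAddCommGroup E] [NormedSpace ℝ E] [CompleteSpace E]
  [NormedAddCommGroup F] [NormedSpace ℝ F]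

/-- The inverse function theorem for smooth maps on an open set: the local inverse can be taken to
be smooth on its whole domain, after shrinking to the points with invertible derivative. -/
theorem exists_openPartialHomeomorph_of_contDiffOn {G : E → F} {U : Set E} (hU : IsOpen U)
    {a : E} (ha : a ∈ U) (hG : ContDiffOn ℝ ∞ G U) {G' : E ≃L[ℝ] F}
    (hG' : HasFDerivAt G (G' : E →L[ℝ] F) a) :
    ∃ e : OpenPartialHomeomorph E F, a ∈ e.source ∧ e.source ⊆ U ∧ (∀ x, e x = G x) ∧
      ContDiffOn ℝ ∞ e.symm e.target := by
  have hcd : ∀ x ∈ U, ContDiffAt ℝ ∞ G x := fun x hx => hG.contDiffAt (hU.mem_nhds hx)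
  have hcont : ContinuousOn (fderiv ℝ G) U := hG.continuousOn_fderiv_of_isOpen hU (by simp)
  let e₀ := (hcd a ha).toOpenPartialHomeomorph G hG' (by simp)
  let V : Set E := U ∩ fderiv ℝ G ⁻¹' Set.range ContinuousLinearEquiv.toContinuousLinearMap
  have hV : IsOpen V := hcont.isOpen_inter_preimage hU ContinuousLinearEquiv.isOpen
  have haV : a ∈ V := ⟨ha, G', hG'.fderiv.symm⟩
  refine ⟨e₀.restrOpen V hV, ⟨(hcd a ha).mem_toOpenPartialHomeomorph_source hG' (by simp), haV⟩,
    fun x hx => hx.2.1, fun x => rfl, fun y hy => ?_⟩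
  set e := e₀.restrOpen V hV
  have hx : e.symm y ∈ e.source := e.map_target hy
  obtain ⟨hxU, A, hA⟩ := hx.2
  have hd : HasFDerivAt e (A : E →L[ℝ] F) (e.symm y) := by
    change HasFDerivAt G (A : E →L[ℝ] F) (e.symm y)
    rw [hA]
    exact ((hcd _ hxU).differentiableAt (by simp)).hasFDerivAt
  exact (e.contDiffAt_symm hy hd (hcd _ hxU)).contDiffWithinAt

end LocalDiffeomorphisms

/-! ### Hadamard's lemma -/

section HadamardLemma

variable {E F : Type*} [NormedAddCommGroup E] [NormedSpace ℝ E]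
  [NormedAddCommGroup F] [NormedSpace ℝ F]

/-- A smooth function near a point agrees near that point with a globally smooth function. -/
theorem exists_contDiff_eventuallyEq [FiniteDimensional ℝ E] {G : E → F} {U : Set E}
    (hU : IsOpen U) {a : E} (ha : a ∈ U) (hG : ContDiffOn ℝ ∞ G U) :
    ∃ H : E → F, ContDiff ℝ ∞ H ∧ H =ᶠ[𝓝 a] G := by
  obtain ⟨r, hr, hrU⟩ := Metric.isOpen_iff.1 hU a ha
  let χ : ContDiffBump a := ⟨r / 4, r / 2, by positivity, by linarith⟩
  have hχU : tsupport χ ⊆ U := by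
    rw [χ.tsupport_eq]
    exact (Metric.closedBall_subset_ball (by change r / 2 < r; linarith)).trans hrU
  refine ⟨fun x => χ x • G x, contDiff_iff_contDiffAt.2 fun x => ?_, ?_⟩
  · by_cases hx : x ∈ tsupport χ
    · exact χ.contDiff.contDiffAt.smul (hG.contDiffAt (hU.mem_nhds (hχU hx)))
    · have h0 : (fun x => χ x • G x) =ᶠ[𝓝 x] fun _ => 0 := by
        filter_upwards [notMem_tsupport_iff_eventuallyEq.1 hx] with y hy
        simp [hy]
      exact contDiffAt_const.congr_of_eventuallyEq h0
  · filter_upwards [χ.eventuallyEq_one] with x hx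
    simp [hx]

open MeasureTheory Convolution in
/-- Differentiation under the integral sign: the integral over `[0, 1]` of a smooth family of
smooth functions is smooth. The integral is the value at `0` of a convolution with the indicator
function of `[0, 1]`, after the family has been cut off in the variable of integration. -/
theorem contDiff_integral_of_contDiff [CompleteSpace F] {g : ℝ → E → F}
    (hg : ContDiff ℝ ∞ fun q : ℝ × E => g q.1 q.2) :
    ContDiff ℝ ∞ fun x => ∫ t in (0 : ℝ)..1, g t x := by
  let χ : ContDiffBump (0 : ℝ) := ⟨1, 2, by norm_num, by norm_num⟩
  let G : E → ℝ → F := fun x t => χ t • g (-t) x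
  have hG : ContDiff ℝ ∞ (fun q : E × ℝ => G q.1 q.2) :=
    (χ.contDiff.comp contDiff_snd).smul (hg.comp (contDiff_snd.neg.prodMk contDiff_fst))
  have hind : LocallyIntegrable (Set.indicator (Set.Ioc (0 : ℝ) 1) fun _ => (1 : ℝ)) volume:= by
    refine Integrable.locallyIntegrable ?_
    rw [integrable_indicator_iff measurableSet_Ioc]
    exact integrableOn_const (by simp) (by simp)
  have hconv := contDiffOn_convolution_right_with_param (𝕜 := ℝ) (μ := volume) (n := ⊤)
    (ContinuousLinearMap.lsmul ℝ ℝ : ℝ →L[ℝ] F →L[ℝ] F) (g := G) (s := Set.univ)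
    (k := Metric.closedBall (0 : ℝ) 2) isOpen_univ (isCompact_closedBall _ _)
    (fun x t _ ht => by
      have : χ t = 0 := by
        apply image_eq_zero_of_notMem_tsupport
        rwa [χ.tsupport_eq]
      simp [G, this]) hind hG.contDiffOn
  rw [Set.univ_prod_univ, contDiffOn_univ] at hconv
  have h0 := hconv.comp (contDiff_id.prodMk (contDiff_const (c := (0 : ℝ))) : ContDiff ℝ ∞
    fun x : E => (x, (0 : ℝ)))
  convert h0 using 2 with x
  simp only [Function.comp_def, convolution_def, id]
  rw [intervalIntegral.integral_of_le zero_le_one, ← integral_indicator measurableSet_Ioc]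
  refine integral_congr_ae (Filter.Eventually.of_forall fun t => ?_)
  by_cases ht : t ∈ Set.Ioc (0 : ℝ) 1
  · have : χ (-t) = 1 := χ.one_of_mem_closedBall (by
      simp only [Metric.mem_closedBall, dist_zero_right, norm_neg, Real.norm_eq_abs]
      exact abs_le.2 ⟨by linarith [ht.1], ht.2⟩)
    simp [ht, G, this]
  · simp [ht]

/-- **Hadamard's lemma**: a smooth function vanishing at `0` is `x ↦ A x x`, with the smooth
family of linear maps `A x = ∫₀¹ DG(t x) dt`. -/
theorem exists_contDiff_clm_apply_self [CompleteSpace F] {G : E → F} (hG : ContDiff ℝ ∞ G)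
    (h0 : G 0 = 0) :
    ∃ A : E → E →L[ℝ] F, ContDiff ℝ ∞ A ∧ A 0 = fderiv ℝ G 0 ∧ ∀ x, G x = A x x := by
  have hdG : ContDiff ℝ ∞ (fderiv ℝ G) := hG.fderiv_right (by simp)
  have hsm : ContDiff ℝ ∞ fun q : ℝ × E => fderiv ℝ G (q.1 • q.2) :=
    hdG.comp (contDiff_fst.smul contDiff_snd)
  refine ⟨fun x => ∫ t in (0 : ℝ)..1, fderiv ℝ G (t • x),
    contDiff_integral_of_contDiff (g := fun t x => fderiv ℝ G (t • x)) hsm, by simp, fun x => ?_⟩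
  have hcont : Continuous fun t : ℝ => fderiv ℝ G (t • x) :=
    hdG.continuous.comp (by fun_prop)
  have hd : ∀ t : ℝ, HasDerivAt (fun t : ℝ => G (t • x)) (fderiv ℝ G (t • x) x) t := fun t => by
    have h1 : HasDerivAt (fun t : ℝ => t • x) x t := by
      simpa using (hasDerivAt_id t).smul_const x
    exact ((hG.differentiable (by simp)) (t • x)).hasFDerivAt.comp_hasDerivAt t h1
  rw [ContinuousLinearMap.intervalIntegral_apply (hcont.intervalIntegrable _ _),
    intervalIntegral.integral_eq_sub_of_hasDerivAt (fun t _ => hd t)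
      ((hcont.clm_apply continuous_const).intervalIntegrable _ _)]
  simp [h0]

end HadamardLemma

/-! ### The Morse lemma -/

section MorseLemma

attribute [local instance] Matrix.linftyOpNormedRing Matrix.linftyOpNormedAlgebra

variable {k : ℕ}

theorem contDiff_matrix_entry (i j : Fin k) :
    ContDiff ℝ ∞ fun M : Matrix (Fin k) (Fin k) ℝ => M i j :=
  (LinearMap.toContinuousLinearMap (Matrix.entryLinearMap ℝ ℝ i j)).contDiff

theorem contDiff_matrix {E : Type*} [NormedAddCommGroup E] [NormedSpace ℝ E]
    {M : E → Matrix (Fin k) (Fin k) ℝ} (hM : ∀ i j, ContDiff ℝ ∞ fun x => M x i j) :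
    ContDiff ℝ ∞ M := by
  have h : M = fun x => ∑ i, ∑ j, M x i j • Matrix.single i j (1 : ℝ) := by
    ext1 x
    conv_lhs => rw [Matrix.matrix_eq_sum_single (M x)]
    simp [Matrix.smul_single]
  rw [h]
  exact ContDiff.sum fun i _ => ContDiff.sum fun j _ => (hM i j).smul contDiff_const

/-- Square roots of matrices near the identity: the inverse function theorem applied to
`P ↦ P * P`, whose derivative at `1` is multiplication by `2`. -/
theorem exists_matrix_sqrt : ∃ e : OpenPartialHomeomorph (Matrix (Fin k) (Fin k) ℝ)
    (Matrix (Fin k) (Fin k) ℝ), 1 ∈ e.source ∧ (∀ P, e P = P * P) ∧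
      ContDiffOn ℝ ∞ e.symm e.target := by
  have hd : HasFDerivAt (fun P : Matrix (Fin k) (Fin k) ℝ => P * P)
      ((ContinuousLinearEquiv.smulLeft (Units.mk0 (2 : ℝ) two_ne_zero) :
        Matrix (Fin k) (Fin k) ℝ ≃L[ℝ] Matrix (Fin k) (Fin k) ℝ) :
        Matrix (Fin k) (Fin k) ℝ →L[ℝ] Matrix (Fin k) (Fin k) ℝ) 1 := by
    have h := (hasFDerivAt_id (𝕜 := ℝ) (1 : Matrix (Fin k) (Fin k) ℝ)).mul'
      (hasFDerivAt_id (𝕜 := ℝ) (1 : Matrix (Fin k) (Fin k) ℝ))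
    refine h.congr_fderiv ?_
    ext1 P
    change 1 * P + P * 1 = (2 : ℝ) • P
    rw [one_mul, mul_one, two_smul]
  obtain ⟨e, h1, -, he, hs⟩ := exists_openPartialHomeomorph_of_contDiffOn isOpen_univ
    (Set.mem_univ (1 : Matrix (Fin k) (Fin k) ℝ)) (contDiff_id.mul contDiff_id).contDiffOn hd
  exact ⟨e, h1, he, hs⟩

/-- A smooth function vanishing to second order at `0` is a smooth family of symmetric matrices
`x ↦ S x`, evaluated at `x` as a quadratic form. -/
theorem exists_symm_matrix_of_vanishing {H : (Fin k → ℝ) → ℝ} (hH : ContDiff ℝ ∞ H) (h0 : H 0 = 0)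
    (h1 : fderiv ℝ H 0 = 0) :
    ∃ S : (Fin k → ℝ) → Matrix (Fin k) (Fin k) ℝ, ContDiff ℝ ∞ S ∧ (∀ x, (S x).transpose = S x) ∧
      ∀ x, H x = x ⬝ᵥ (S x).mulVec x := by
  obtain ⟨A, hA, hA0, hHA⟩ := exists_contDiff_clm_apply_self hH h0
  obtain ⟨B, hB, -, hAB⟩ := exists_contDiff_clm_apply_self hA (hA0.trans h1)
  have hB' : ∀ i j : Fin k, ContDiff ℝ ∞ fun x => B x (Pi.single i 1) (Pi.single j 1) :=
    fun i j => (hB.clm_apply contDiff_const).clm_apply contDiff_const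
  have hexp : ∀ x, H x = ∑ i, ∑ j, x i * (B x (Pi.single i 1) (Pi.single j 1) * x j) := by
    intro x
    have hx : x = ∑ i, x i • (Pi.single i 1 : Fin k → ℝ) := by
      simpa using pi_eq_sum_univ' x
    rw [hHA, hAB]
    have key : ∀ L : (Fin k → ℝ) →L[ℝ] (Fin k → ℝ) →L[ℝ] ℝ, L x x =
        ∑ i, ∑ j, x i * (L (Pi.single i 1) (Pi.single j 1) * x j) := by
      intro L
      conv_lhs => rw [hx]
      simp only [map_sum, map_smul, sum_apply,
        smul_apply, smul_eq_mul, Finset.mul_sum]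
      rw [Finset.sum_comm]
      refine Finset.sum_congr rfl fun i _ => Finset.sum_congr rfl fun j _ => by ring
    exact key _
  refine ⟨fun x => Matrix.of fun i j => (B x (Pi.single i 1) (Pi.single j 1) +
    B x (Pi.single j 1) (Pi.single i 1)) / 2, ?_, fun x => ?_, fun x => ?_⟩
  · refine contDiff_matrix fun i j => ?_
    exact ((hB' i j).add (hB' j i)).div_const 2
  · ext i j
    simp [add_comm]
  · have hexp' : H x = ∑ i, ∑ j, x i * (B x (Pi.single j 1) (Pi.single i 1) * x j) := by
      rw [hexp, Finset.sum_comm]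
      refine Finset.sum_congr rfl fun i _ => Finset.sum_congr rfl fun j _ => by ring
    have h2 : H x = (H x + H x) / 2 := by ring
    rw [h2]
    nth_rewrite 1 [hexp]
    rw [hexp', ← Finset.sum_add_distrib, Finset.sum_div]
    simp only [dotProduct, Matrix.mulVec, Matrix.of_apply, Finset.mul_sum]
    refine Finset.sum_congr rfl fun i _ => ?_
    rw [← Finset.sum_add_distrib, Finset.sum_div]
    refine Finset.sum_congr rfl fun j _ => by ring

/-- A symmetric matrix is determined by its quadratic form. -/
theorem eq_of_dotProduct_mulVec_eq {S T : Matrix (Fin k) (Fin k) ℝ} (hS : S.transpose = S)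
    (hT : T.transpose = T) (h : ∀ x, x ⬝ᵥ S.mulVec x = x ⬝ᵥ T.mulVec x) : S = T := by
  have pol : ∀ M : Matrix (Fin k) (Fin k) ℝ, M.transpose = M → ∀ x y,
      2 * (x ⬝ᵥ M.mulVec y) = (x + y) ⬝ᵥ M.mulVec (x + y) - x ⬝ᵥ M.mulVec x
        - y ⬝ᵥ M.mulVec y := by
    intro M hM x y
    have : y ⬝ᵥ M.mulVec x = x ⬝ᵥ M.mulVec y := by
      rw [dotProduct_comm, ← Matrix.vecMul_transpose, hM, Matrix.dotProduct_mulVec]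
    simp only [Matrix.mulVec_add, dotProduct_add, add_dotProduct, this]
    ring
  ext i j
  have h2 : 2 * ((Pi.single i 1 : Fin k → ℝ) ⬝ᵥ S.mulVec (Pi.single j 1)) =
      2 * ((Pi.single i 1 : Fin k → ℝ) ⬝ᵥ T.mulVec (Pi.single j 1)) := by
    rw [pol S hS, pol T hT, h, h, h]
  simpa using h2

/-- **Morse lemma**, with the Hessian at the critical point already in normal form: the quadratic
form `∑ σᵢ xᵢ²` is the second-order part of `F` at `0`. -/
theorem exists_morse_chart {σ : Fin k → ℝ} (hσ : ∀ i, σ i = 1 ∨ σ i = -1)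
    {F : (Fin k → ℝ) → ℝ} {Ω : Set (Fin k → ℝ)} (hΩ : IsOpen Ω) (h0Ω : (0 : Fin k → ℝ) ∈ Ω)
    (hF : ContDiffOn ℝ ∞ F Ω) (hF0 : F 0 = 0) (hF1 : HasFDerivAt F (0 : (Fin k → ℝ) →L[ℝ] ℝ) 0)
    (hF2 : ∀ ξ : Fin k → ℝ, Filter.Tendsto (fun t : ℝ => F (t • ξ) / t ^ 2) (𝓝[≠] 0)
      (𝓝 (∑ i, σ i * ξ i ^ 2))) :
    ∃ e : OpenPartialHomeomorph (Fin k → ℝ) (Fin k → ℝ), 0 ∈ e.source ∧ e 0 = 0 ∧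
      e.source ⊆ Ω ∧ ContDiffOn ℝ ∞ e e.source ∧ ContDiffOn ℝ ∞ e.symm e.target ∧
      ∀ x ∈ e.source, F x = ∑ i, σ i * e x i ^ 2 := by
  obtain ⟨H, hH, hHF⟩ := exists_contDiff_eventuallyEq hΩ h0Ω hF
  obtain ⟨S, hS, hSt, hHS⟩ := exists_symm_matrix_of_vanishing hH (hHF.eq_of_nhds.trans hF0)
    (hHF.fderiv_eq.trans hF1.fderiv)
  set D : Matrix (Fin k) (Fin k) ℝ := Matrix.diagonal σ with hD
  have hDD : D * D = 1 := by
    rw [hD, Matrix.diagonal_mul_diagonal, ← Matrix.diagonal_one]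
    congr 1
    ext i
    rcases hσ i with h | h <;> simp [h]
  have hDt : D.transpose = D := Matrix.diagonal_transpose _
  have hDq : ∀ y : Fin k → ℝ, y ⬝ᵥ D.mulVec y = ∑ i, σ i * y i ^ 2 := fun y => by
    simp only [dotProduct, hD, Matrix.mulVec_diagonal]
    exact Finset.sum_congr rfl fun i _ => by ring
  have hS0 : S 0 = D := by
    refine eq_of_dotProduct_mulVec_eq (hSt 0) hDt fun ξ => ?_
    rw [hDq]
    refine tendsto_nhds_unique ?_ (hF2 ξ)
    have hline : Filter.Tendsto (fun t : ℝ => t • ξ) (𝓝[≠] 0) (𝓝 0) := by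
      have : Continuous fun t : ℝ => t • ξ := by fun_prop
      simpa using (this.tendsto 0).mono_left nhdsWithin_le_nhds
    have hc : Continuous fun x => ξ ⬝ᵥ (S x).mulVec ξ :=
      continuous_const.dotProduct (hS.continuous.matrix_mulVec continuous_const)
    refine ((hc.tendsto 0).comp hline).congr' ?_
    filter_upwards [hline.eventually hHF, self_mem_nhdsWithin] with t ht ht0
    have ht0 : t ≠ 0 := ht0
    rw [← ht, hHS]
    simp only [Function.comp_apply, Matrix.mulVec_smul, smul_dotProduct, dotProduct_smul,
      smul_eq_mul]
    field_simp
  obtain ⟨r, hr1, hr, hrs⟩ := exists_matrix_sqrt (k := k)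
  have hr1' : r 1 = 1 := by rw [hr, one_mul]
  have hrsymm1 : r.symm 1 = 1 := by
    conv_lhs => rw [← hr1']
    exact r.left_inv hr1
  have hM : ContDiff ℝ ∞ fun x => D * S x := contDiff_const.mul hS
  let P : (Fin k → ℝ) → Matrix (Fin k) (Fin k) ℝ := fun x => r.symm (D * S x)
  have hP0 : P 0 = 1 := by simp only [P, hS0, hDD, hrsymm1]
  let V₁ : Set (Fin k → ℝ) := (fun x => D * S x) ⁻¹' r.target
  have hV₁ : IsOpen V₁ := r.open_target.preimage hM.continuous
  have hP : ContDiffOn ℝ ∞ P V₁ := hrs.comp hM.contDiffOn fun x hx => hx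
  have h0V₁ : (0 : Fin k → ℝ) ∈ V₁ := by
    change D * S 0 ∈ r.target
    rw [hS0, hDD, ← hr1']
    exact r.map_source hr1
  -- The `D`-adjoint `D * Pᵀ * D` of the square root is a second square root near `1`,
  -- so it equals `P`: this is what makes `Pᵀ * D * P` equal to `D * P * P`.
  have hadj : ∀ᶠ x in 𝓝 0, D * (P x).transpose * D = P x := by
    have hPc : ContinuousAt P 0 := hP.continuousOn.continuousAt (hV₁.mem_nhds h0V₁)
    have hc : ContinuousAt (fun x => D * (P x).transpose * D) 0 := by
      have : Continuous fun M : Matrix (Fin k) (Fin k) ℝ => D * M.transpose * D := by fun_prop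
      exact this.continuousAt.comp hPc
    have hmem : ∀ᶠ x in 𝓝 0, D * (P x).transpose * D ∈ r.source := by
      refine hc.eventually_mem ?_
      rw [hP0, Matrix.transpose_one, mul_one, hDD]
      exact r.open_source.mem_nhds hr1
    filter_upwards [hmem, hV₁.mem_nhds h0V₁] with x hx hxV
    refine r.injOn hx (r.map_target hxV) ?_
    rw [r.right_inv hxV, hr]
    have hPP : P x * P x = D * S x := by rw [← hr]; exact r.right_inv hxV
    calc D * (P x).transpose * D * (D * (P x).transpose * D)
        = D * (P x).transpose * (D * D) * (P x).transpose * D := by simp only [mul_assoc]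
      _ = D * (P x * P x).transpose * D := by
          rw [hDD, mul_one, Matrix.transpose_mul]; simp only [mul_assoc]
      _ = D * S x := by
          rw [hPP, Matrix.transpose_mul, hSt, hDt, mul_assoc, mul_assoc, hDD, mul_one]
  obtain ⟨V₂, hV₂sub, hV₂, h0V₂⟩ := eventually_nhds_iff.1 (hadj.and hHF)
  let G : (Fin k → ℝ) → (Fin k → ℝ) := fun x => (P x).mulVec x
  have hG : ContDiffOn ℝ ∞ G (V₁ ∩ V₂ ∩ Ω) := by
    refine contDiffOn_pi.2 fun i => ?_
    simp only [G, Matrix.mulVec, dotProduct]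
    refine ContDiffOn.sum fun j _ => ?_
    have hPij : ContDiffOn ℝ ∞ (fun x => P x i j) V₁ :=
      (contDiff_matrix_entry i j).comp_contDiffOn hP
    exact (hPij.mono fun x hx => hx.1.1).mul (contDiff_apply ℝ ℝ j).contDiffOn
  have hG' : HasFDerivAt G ((ContinuousLinearEquiv.refl ℝ (Fin k → ℝ) :
      (Fin k → ℝ) ≃L[ℝ] (Fin k → ℝ)) : (Fin k → ℝ) →L[ℝ] (Fin k → ℝ)) 0 := by
    rw [hasFDerivAt_pi']
    intro i
    have hPij : ∀ j, HasFDerivAt (fun x => P x i j) (fderiv ℝ (fun x => P x i j) 0) 0 := fun j =>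
      ((((contDiff_matrix_entry i j).comp_contDiffOn hP).contDiffAt
        (hV₁.mem_nhds h0V₁)).differentiableAt (by simp)).hasFDerivAt
    have hsum : HasFDerivAt (fun x : Fin k → ℝ => ∑ j, P x i j * x j) _ 0 :=
      HasFDerivAt.fun_sum fun j _ => (hPij j).mul (hasFDerivAt_apply j (0 : Fin k → ℝ))
    refine hsum.congr_fderiv ?_
    ext1 v
    simp [hP0, Matrix.one_apply]
  obtain ⟨e, h0e, heU, heG, hes⟩ := exists_openPartialHomeomorph_of_contDiffOn
    ((hV₁.inter hV₂).inter hΩ) ⟨⟨h0V₁, h0V₂⟩, h0Ω⟩ hG hG'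
  refine ⟨e, h0e, by simp [heG, G], fun x hx => (heU hx).2,
    (hG.mono heU).congr fun x _ => heG x, hes, fun x hx => ?_⟩
  obtain ⟨⟨hx1, hx2⟩, -⟩ := heU hx
  obtain ⟨hx3, hx4⟩ := hV₂sub x hx2
  have hPP : P x * P x = D * S x := by rw [← hr]; exact r.right_inv hx1
  have hS' : (P x).transpose * D * P x = S x := by
    calc (P x).transpose * D * P x = D * (D * (P x).transpose * D) * P x := by
          simp only [← mul_assoc]; rw [hDD, one_mul]
      _ = S x := by rw [hx3, mul_assoc, hPP, ← mul_assoc, hDD, one_mul]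
  rw [← hDq, heG, ← hx4, hHS, ← hS']
  simp only [G]
  rw [← Matrix.mulVec_mulVec, ← Matrix.mulVec_mulVec, Matrix.dotProduct_mulVec,
    Matrix.vecMul_transpose]

end MorseLemma

/-! ### Second-order expansion at a critical point -/

section SecondOrder

variable {E : Type*} [NormedAddCommGroup E] [NormedSpace ℂ E] {h : E → ℂ} {p : E}

/-- Second-order Taylor expansion of an analytic function at a critical point. -/
theorem isLittleO_sub_hessian_of_critical (hh : AnalyticAt ℂ h p) (h1 : fderiv ℂ h p = 0) :
    (fun y => h (p + y) - h p - fderiv ℂ (fderiv ℂ h) p y y / 2) =o[𝓝 0]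
      fun y : E => ‖y‖ ^ 2 := by
  set B := fderiv ℂ (fderiv ℂ h) p
  have hsymm : ∀ v w, B v w = B w v := fun v w =>
    (hh.contDiffAt (n := ⊤)).isSymmSndFDerivAt (by simp) v w
  have hfd : HasFDerivAt (fderiv ℂ h) B p := hh.fderiv.differentiableAt.hasFDerivAt
  have hlo : (fun y => fderiv ℂ h (p + y) - B y) =o[𝓝 0] fun y : E => y := by
    simpa [h1] using hasFDerivAt_iff_isLittleO_nhds_zero.1 hfd
  have hev : ∀ᶠ y in 𝓝 (0 : E), AnalyticAt ℂ h (p + y) := by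
    have : Filter.Tendsto (fun y : E => p + y) (𝓝 0) (𝓝 p) := by
      simpa using (continuous_const_add p).tendsto 0
    exact this.eventually hh.eventually_analyticAt
  refine Asymptotics.isLittleO_iff.2 fun c hc => ?_
  obtain ⟨δ, hδ, hball⟩ := Metric.eventually_nhds_iff_ball.1
    ((Asymptotics.isLittleO_iff.1 hlo hc).and hev)
  filter_upwards [Metric.ball_mem_nhds (0 : E) hδ] with y hy
  have hsub : ∀ z ∈ Metric.closedBall (0 : E) ‖y‖, z ∈ Metric.ball (0 : E) δ := fun z hz => by
    simp only [Metric.mem_closedBall, Metric.mem_ball, dist_zero_right] at hz hy ⊢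
    exact hz.trans_lt hy
  have hR : ∀ z ∈ Metric.closedBall (0 : E) ‖y‖, HasFDerivWithinAt
      (fun y => h (p + y) - h p - B y y / 2) (fderiv ℂ h (p + z) - B z)
      (Metric.closedBall (0 : E) ‖y‖) z := fun z hz => by
    have hd : HasFDerivAt (fun y => h (p + y)) (fderiv ℂ h (p + z)) z :=
      (hasFDerivAt_comp_add_left p).2 (hball z (hsub z hz)).2.differentiableAt.hasFDerivAt
    have hq : HasFDerivAt (fun y => B y y) (B z + B.flip z) z := by
      refine (B.hasFDerivAt.clm_apply (hasFDerivAt_id z)).congr_fderiv ?_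
      ext1 v
      simp
    refine HasFDerivAt.hasFDerivWithinAt ?_
    have hq2 : HasFDerivAt (fun y => B y y / 2) ((2 : ℂ)⁻¹ • (B z + B.flip z)) z := by
      simpa only [div_eq_inv_mul] using hq.const_mul (2 : ℂ)⁻¹
    refine ((hd.sub_const (h p)).sub hq2).congr_fderiv ?_
    ext1 v
    simp only [sub_apply, add_apply, smul_apply, ContinuousLinearMap.flip_apply, smul_eq_mul,
      hsymm v z]
    ring
  have hmv := (convex_closedBall (0 : E) ‖y‖).norm_image_sub_le_of_norm_hasFDerivWithin_le
    (𝕜 := ℂ) hR (C := c * ‖y‖) (fun z hz => ((hball z (hsub z hz)).1).trans (by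
      have : ‖z‖ ≤ ‖y‖ := by simpa using hz
      gcongr)) (Metric.mem_closedBall_self (norm_nonneg y)) (y := y) (by simp)
  simp only [add_zero, sub_self, map_zero, zero_div, sub_zero] at hmv
  calc _ ≤ c * ‖y‖ * ‖y‖ := hmv
    _ = _ := by simp; ring

/-- Along a curve through a critical point, the second-order part of an analytic function depends
only on the velocity of the curve. -/
theorem tendsto_div_sq_of_critical (hh : AnalyticAt ℂ h p) (h1 : fderiv ℂ h p = 0)
    {γ : ℝ → E} {v : E} (hγ0 : γ 0 = p) (hγ : HasDerivAt γ v 0) :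
    Filter.Tendsto (fun t : ℝ => ((h (γ t)).re - (h p).re) / t ^ 2) (𝓝[≠] 0)
      (𝓝 ((fderiv ℂ (fderiv ℂ h) p v v).re / 2)) := by
  set B := fderiv ℂ (fderiv ℂ h) p
  have hsl : Filter.Tendsto (fun t : ℝ => t⁻¹ • (γ t - p)) (𝓝[≠] 0) (𝓝 v) := by
    simpa [slope_fun_def, hγ0] using hasDerivAt_iff_tendsto_slope.1 hγ
  have hγt : Filter.Tendsto (fun t : ℝ => γ t - p) (𝓝[≠] 0) (𝓝 0) := by
    have := (hγ.continuousAt.tendsto.sub_const p).mono_left (nhdsWithin_le_nhds (s := {0}ᶜ))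
    simpa [hγ0] using this
  have hbig : (fun t : ℝ => γ t - p) =O[𝓝[≠] 0] fun t : ℝ => t := by
    have := hγ.isBigO_sub.mono (nhdsWithin_le_nhds (s := {0}ᶜ))
    simpa [hγ0] using this
  have hlo : (fun t : ℝ => h (γ t) - h p - B (γ t - p) (γ t - p) / 2) =o[𝓝[≠] 0]
      fun t : ℝ => t ^ 2 := by
    have := ((isLittleO_sub_hessian_of_critical hh h1).comp_tendsto hγt).trans_isBigO
      ((hbig.norm_left.pow 2))
    simpa [Function.comp_def] using this
  have hlo' : Filter.Tendsto (fun t : ℝ => (t ^ 2)⁻¹ •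
      (h (γ t) - h p - B (γ t - p) (γ t - p) / 2)) (𝓝[≠] 0) (𝓝 0) :=
    hlo.tendsto_inv_smul_nhds_zero
  have hq : Filter.Tendsto (fun t : ℝ => B (t⁻¹ • (γ t - p)) (t⁻¹ • (γ t - p)) / 2) (𝓝[≠] 0)
      (𝓝 (B v v / 2)) := by
    have : Continuous fun w => B w w / 2 := by fun_prop
    exact (this.tendsto v).comp hsl
  have hsum := (Complex.continuous_re.tendsto _).comp (hlo'.add hq)
  have hlim : ((0 : ℂ) + B v v / 2).re = (B v v).re / 2 := by simp
  rw [hlim] at hsum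
  refine hsum.congr' ?_
  filter_upwards [self_mem_nhdsWithin] with t ht
  have ht0 : t ≠ 0 := ht
  have hBt : B (t⁻¹ • (γ t - p)) (t⁻¹ • (γ t - p)) =
      ((t ^ 2)⁻¹ : ℝ) • B (γ t - p) (γ t - p) := by
    have hr : ∀ w : E, (t⁻¹ : ℝ) • w = ((t⁻¹ : ℝ) : ℂ) • w := fun w => by
      rw [Complex.coe_smul]
    rw [hr]
    simp only [map_smul, smul_apply, smul_eq_mul, Complex.real_smul]
    push_cast
    ring
  simp only [Function.comp_apply]
  rw [hBt, Complex.add_re]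
  simp only [Complex.real_smul, Complex.re_ofReal_mul, Complex.sub_re, Complex.div_ofNat_re]
  field_simp
  ring

end SecondOrder

/-! ### Quadratic forms -/

section LinearAlgebra

/-- **Sylvester's law of inertia** in coordinates: a nondegenerate symmetric real bilinear form on
a `k`-dimensional space is `∑ σᵢ xᵢ²`, with signs `σᵢ`, in suitable linear coordinates. -/
theorem exists_linearEquiv_sum_sq {M : Type*} [AddCommGroup M] [Module ℝ M] [FiniteDimensional ℝ M]
    {k : ℕ} (hk : Module.finrank ℝ M = k) (B : LinearMap.BilinForm ℝ M)
    (hB : ∀ v w, B v w = B w v) (hnd : ∀ v, (∀ w, B v w = 0) → v = 0) :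
    ∃ (σ : Fin k → ℝ) (L : (Fin k → ℝ) ≃ₗ[ℝ] M), (∀ i, σ i = 1 ∨ σ i = -1) ∧
      ∀ x, B (L x) (L x) = ∑ i, σ i * x i ^ 2 := by
  subst hk
  have hassoc : QuadraticMap.associated (R := ℝ) (LinearMap.BilinMap.toQuadraticMap B) = B :=
    QuadraticMap.associated_left_inverse ℝ hB
  obtain ⟨σ, hσ, ⟨e⟩⟩ := QuadraticForm.equivalent_one_neg_one_weighted_sum_squared
    (LinearMap.BilinMap.toQuadraticMap B) (by rw [hassoc]; exact hnd)
  refine ⟨σ, e.symm.toLinearEquiv, fun i => (hσ i).symm, fun x => ?_⟩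
  have := e.symm.map_app x
  simp only [LinearMap.BilinMap.toQuadraticMap_apply, QuadraticMap.weightedSumSquares_apply,
    smul_eq_mul] at this
  simpa [pow_two] using this

variable {V : Type*} [AddCommGroup V] [Module ℂ V]

/-- The Gram matrix of a bilinear form on a basis of a subspace is invertible exactly when the form
is nondegenerate there, and then so is its real part. -/
theorem det_ne_zero_iff_re_nondegenerate {m : ℕ} (B : V →ₗ[ℂ] V →ₗ[ℂ] ℂ) {b : Fin m → V}
    (hb : LinearIndependent ℂ b) (hB : ∀ v w, B v w = B w v) :
    (Matrix.of fun i j => B (b i) (b j)).det ≠ 0 ↔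
      ∀ v ∈ Submodule.span ℂ (Set.range b),
        (∀ w ∈ Submodule.span ℂ (Set.range b), (B v w).re = 0) → v = 0 := by
  have hmul : ∀ (c : Fin m → ℂ) i, (Matrix.of fun i j => B (b i) (b j)).mulVec c i =
      B (b i) (∑ j, c j • b j) := fun c i => by
    simp [Matrix.mulVec, dotProduct, mul_comm]
  constructor
  · intro hdet v hv hvw
    obtain ⟨c, rfl⟩ := (Submodule.mem_span_range_iff_exists_fun ℂ).1 hv
    have hc : c = 0 := by
      refine Matrix.eq_zero_of_mulVec_eq_zero hdet (funext fun i => ?_)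
      have hi : b i ∈ Submodule.span ℂ (Set.range b) := Submodule.subset_span ⟨i, rfl⟩
      have h1 := hvw _ hi
      have h2 := hvw _ (Submodule.smul_mem _ Complex.I hi)
      rw [hmul, hB]
      simp only [map_smul, smul_eq_mul, Complex.mul_re, Complex.I_re, Complex.I_im] at h2
      exact Complex.ext (by simpa using h1) (by simpa using h2)
    simp [hc]
  · intro h hdet
    obtain ⟨c, hc0, hc⟩ := Matrix.exists_mulVec_eq_zero_iff.2 hdet
    refine hc0 (funext fun i => ?_)
    refine Fintype.linearIndependent_iff.1 hb c (h _ ?_ fun w hw => ?_) i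
    · exact Submodule.sum_mem _ fun i _ => Submodule.smul_mem _ _ (Submodule.subset_span ⟨i, rfl⟩)
    · have hz : B (∑ j, c j • b j) w = 0 := by
        obtain ⟨d, rfl⟩ := (Submodule.mem_span_range_iff_exists_fun ℂ).1 hw
        rw [hB, map_sum B, LinearMap.sum_apply]
        refine Finset.sum_eq_zero fun i _ => ?_
        rw [map_smul, LinearMap.smul_apply, ← hmul c i, hc]
        simp
      rw [hz, Complex.zero_re]

end LinearAlgebra

/-! ### Weighted homogeneous polynomials -/

section WeightedHomogeneous

variable {n : ℕ} {f : MvPolynomial (Fin n) ℂ} {w : Fin n → ℚ}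

/-- The complex one-parameter group `z ↦ (exp (ζ / w₁) z₁, …, exp (ζ / w_n) z_n)` attached to the
weights `w`. -/
def weightedFlow (w : Fin n → ℚ) (ζ : ℂ) (z : EuclideanSpace ℂ (Fin n)) :
    EuclideanSpace ℂ (Fin n) :=
  WithLp.toLp 2 fun j => Complex.exp (ζ / w j) * z j

/-- The weighted Euler vector field `(z₁ / w₁, …, z_n / w_n)`, the velocity of `weightedFlow` at
time zero. -/
def weightedEuler (w : Fin n → ℚ) (z : EuclideanSpace ℂ (Fin n)) : EuclideanSpace ℂ (Fin n) :=
  WithLp.toLp 2 fun j => z j / w j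

/-- The Euler relation forces every monomial of `f` to have weighted degree one. -/
theorem HasWeights.sum_div_eq_one (hf : HasWeights f w) {a : Fin n →₀ ℕ}
    (ha : a ∈ f.support) : ∑ j, (a j : ℂ) / w j = 1 := by
  have hcoeff : ∀ (F : MvPolynomial (Fin n) ℂ) (b : Fin n →₀ ℕ),
      MvPolynomial.coeff b (∑ j, MvPolynomial.C (1 / (w j : ℂ)) * MvPolynomial.X j *
        MvPolynomial.pderiv j F) = (∑ j, (b j : ℂ) / w j) * MvPolynomial.coeff b F := by
    intro F b
    induction F using MvPolynomial.induction_on' with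
    | monomial m c =>
      simp only [mul_assoc, MvPolynomial.X_mul_pderiv_monomial, MvPolynomial.coeff_sum,
        MvPolynomial.coeff_C_mul, MvPolynomial.coeff_smul, MvPolynomial.coeff_monomial,
        Finset.sum_mul]
      refine Finset.sum_congr rfl fun j _ => ?_
      by_cases h : m = b
      · subst h
        simp
        ring
      · simp [h]
    | add p q hp hq =>
      simp only [map_add, mul_add, Finset.sum_add_distrib, MvPolynomial.coeff_add, hp, hq]
  have h := hcoeff f a
  rw [hf.euler] at h
  have h0 : MvPolynomial.coeff a f ≠ 0 := MvPolynomial.mem_support_iff.1 ha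
  exact (mul_right_cancel₀ h0 (by rw [one_mul]; exact h)).symm

theorem HasWeights.polyVal_weightedFlow (hf : HasWeights f w) (ζ : ℂ)
    (z : EuclideanSpace ℂ (Fin n)) :
    polyVal f (weightedFlow w ζ z) = Complex.exp ζ * polyVal f z := by
  simp only [polyVal, MvPolynomial.eval_eq', Finset.mul_sum, weightedFlow]
  refine Finset.sum_congr rfl fun a ha => ?_
  have h1 : ∏ j, Complex.exp (ζ / w j) ^ a j = Complex.exp ζ := by
    simp only [← Complex.exp_nat_mul, ← Complex.exp_sum]
    congr 1
    conv_rhs => rw [← mul_one ζ, ← hf.sum_div_eq_one ha, Finset.mul_sum]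
    exact Finset.sum_congr rfl fun j _ => by ring
  simp only [mul_pow, Finset.prod_mul_distrib, h1]
  ring

theorem weightedFlow_rescale {s : ℚ} (hs : 0 < s) (ζ : ℂ) (z : EuclideanSpace ℂ (Fin n)) :
    weightedFlow (fun j => s * w j) (s * ζ) z = weightedFlow w ζ z := by
  have : (s : ℂ) ≠ 0 := by exact_mod_cast hs.ne'
  simp [weightedFlow, mul_div_mul_left _ _ this]

theorem weightedEuler_rescale {s : ℚ} (hs : 0 < s) (z : EuclideanSpace ℂ (Fin n)) :
    (s : ℂ) • weightedEuler (fun j => s * w j) z = weightedEuler w z := by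
  have : (s : ℂ) ≠ 0 := by exact_mod_cast hs.ne'
  ext j
  simp only [weightedEuler, PiLp.smul_apply, smul_eq_mul]
  push_cast
  rw [← mul_div_assoc, mul_div_mul_left _ _ this]

theorem weightedFlow_zero (z : EuclideanSpace ℂ (Fin n)) : weightedFlow w 0 z = z := by
  ext j
  simp [weightedFlow]

theorem norm_weightedFlow_mul_I (t : ℝ) (z : EuclideanSpace ℂ (Fin n)) :
    ‖weightedFlow w (t * Complex.I) z‖ = ‖z‖ := by
  simp only [EuclideanSpace.norm_eq, weightedFlow, norm_mul]
  have : ∀ j, ‖Complex.exp (t * Complex.I / w j)‖ = 1 := fun j => by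
    have : (t * Complex.I / w j : ℂ) = ((t / w j : ℝ) : ℂ) * Complex.I := by
      push_cast
      ring
    rw [this, Complex.norm_exp_ofReal_mul_I]
  simp [this]

theorem contDiff_weightedFlow : ContDiff ℂ ∞
    fun q : ℂ × EuclideanSpace ℂ (Fin n) => weightedFlow w q.1 q.2 := by
  refine contDiff_euclidean.2 fun j => ?_
  have h : ContDiff ℂ ∞ fun z : EuclideanSpace ℂ (Fin n) => z j :=
    (EuclideanSpace.proj j : EuclideanSpace ℂ (Fin n) →L[ℂ] ℂ).contDiff
  exact ((contDiff_fst.div_const _).cexp).mul (h.comp contDiff_snd)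

theorem hasFDerivAt_weightedFlow (p : EuclideanSpace ℂ (Fin n)) :
    HasFDerivAt (fun q : ℂ × EuclideanSpace ℂ (Fin n) => weightedFlow w q.1 q.2)
      ((ContinuousLinearMap.fst ℂ ℂ _).smulRight (weightedEuler w p) +
        ContinuousLinearMap.snd ℂ ℂ _) (0, p) := by
  rw [← hasFDerivWithinAt_univ, hasFDerivWithinAt_euclidean]
  intro j
  rw [hasFDerivWithinAt_univ]
  have h1 : HasFDerivAt (fun q : ℂ × EuclideanSpace ℂ (Fin n) => Complex.exp (q.1 / w j)) _
      (0, p) :=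
    ((hasFDerivAt_fst (𝕜 := ℂ) (p := ((0 : ℂ), p))).mul_const (w j : ℂ)⁻¹).cexp
  have h2 : HasFDerivAt (fun q : ℂ × EuclideanSpace ℂ (Fin n) => q.2 j) _ (0, p) :=
    (EuclideanSpace.proj j : EuclideanSpace ℂ (Fin n) →L[ℂ] ℂ).hasFDerivAt.comp (0, p)
      hasFDerivAt_snd
  refine (h1.mul h2).congr_fderiv ?_
  ext <;> simp [weightedEuler]
  ring

theorem exists_inner_weightedEuler (hw : ∀ j, 0 < w j) {p : EuclideanSpace ℂ (Fin n)}
    (hp : p ≠ 0) : ∃ c : ℝ, 0 < c ∧ inner ℂ p (weightedEuler w p) = (c : ℂ) := by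
  refine ⟨∑ j, ‖p j‖ ^ 2 / w j, ?_, ?_⟩
  · obtain ⟨j, hj⟩ : ∃ j, p j ≠ 0 := by
      by_contra! h
      exact hp (by ext j; simp [h j])
    refine Finset.sum_pos' (fun i _ => ?_) ⟨j, Finset.mem_univ j, ?_⟩
    · have : (0 : ℝ) < w i := by exact_mod_cast hw i
      positivity
    · have : (0 : ℝ) < w j := by exact_mod_cast hw j
      positivity
  · simp only [PiLp.inner_apply, weightedEuler, RCLike.inner_apply]
    push_cast
    refine Finset.sum_congr rfl fun j _ => ?_
    rw [← Complex.mul_conj' (p j)]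
    ring

variable {p : EuclideanSpace ℂ (Fin n)} {l : EuclideanSpace ℂ (Fin n) → ℂ}

theorem IsLogBranch.polyVal_ne_zero (hl : IsLogBranch f p l) : polyVal f p ≠ 0 :=
  hl.exp_eq.self_of_nhds ▸ Complex.exp_ne_zero _

/-- The Euler relation for a branch of the logarithm. -/
theorem IsLogBranch.fderiv_weightedEuler (hl : IsLogBranch f p l) (hf : HasWeights f w) :
    fderiv ℂ l p (weightedEuler w p) = 1 := by
  have hflow : HasDerivAt (fun ζ : ℂ => weightedFlow w ζ p) (weightedEuler w p) 0 := by
    have := (hasFDerivAt_weightedFlow (w := w) p).comp_hasDerivAt (0 : ℂ)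
      ((hasDerivAt_id (0 : ℂ)).prodMk (hasDerivAt_const (0 : ℂ) p))
    simpa [Function.comp_def] using this
  have hl' : HasFDerivAt l (fderiv ℂ l p) (weightedFlow w 0 p) := by
    rw [weightedFlow_zero]
    exact hl.analyticAt.differentiableAt.hasFDerivAt
  have h1 := (hl'.comp_hasDerivAt (0 : ℂ) hflow).cexp
  have htend : Filter.Tendsto (fun ζ : ℂ => weightedFlow w ζ p) (𝓝 0) (𝓝 p) := by
    simpa [weightedFlow_zero] using hflow.continuousAt.tendsto
  have h2 : HasDerivAt (fun ζ : ℂ => Complex.exp (l (weightedFlow w ζ p)))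
      (Complex.exp 0 * polyVal f p) 0 := by
    refine ((Complex.hasDerivAt_exp 0).mul_const (polyVal f p)).congr_of_eventuallyEq ?_
    filter_upwards [htend.eventually hl.exp_eq] with ζ hζ
    rw [hζ, hf.polyVal_weightedFlow]
  have h3 := h1.unique h2
  simp only [Function.comp_apply, weightedFlow_zero, hl.exp_eq.self_of_nhds, Complex.exp_zero,
    one_mul] at h3
  exact mul_left_cancel₀ hl.polyVal_ne_zero (h3.trans (mul_one _).symm)

theorem exp_div_norm_exp (a : ℂ) :
    Complex.exp a / ‖Complex.exp a‖ = Complex.exp (a.im * Complex.I) := by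
  rw [Complex.norm_exp, Complex.ofReal_exp, ← Complex.exp_sub]
  congr 1
  nth_rewrite 1 [← Complex.re_add_im a]
  ring

theorem IsLogBranch.polyVal_div_norm (hl : IsLogBranch f p l) :
    ∀ᶠ z in 𝓝 p, polyVal f z / ‖polyVal f z‖ = Complex.exp ((l z).im * Complex.I) := by
  filter_upwards [hl.exp_eq] with z hz
  rw [← hz, exp_div_norm_exp]

theorem fderiv_apply_eq_inner_grad (h : EuclideanSpace ℂ (Fin n) → ℂ)
    (p v : EuclideanSpace ℂ (Fin n)) : fderiv ℂ h p v = inner ℂ (grad h p) v := by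
  have hv : v = ∑ j, v j • EuclideanSpace.single j (1 : ℂ) := by
    ext i
    simp [Finset.sum_apply, Pi.single_apply]
  conv_lhs => rw [hv]
  simp [grad, partialDeriv, PiLp.inner_apply]

theorem hess_apply {h : EuclideanSpace ℂ (Fin n) → ℂ} (hh : AnalyticAt ℂ h p) (j k : Fin n) :
    hess h p j k = fderiv ℂ (fderiv ℂ h) p (EuclideanSpace.single j 1)
      (EuclideanSpace.single k 1) := by
  simp only [hess, Matrix.of_apply]
  change fderiv ℂ (fun z => fderiv ℂ h z (EuclideanSpace.single k 1)) p
    (EuclideanSpace.single j 1) = _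
  rw [fderiv_clm_apply hh.fderiv.differentiableAt (differentiableAt_const _)]
  simp

theorem transpose_mul_hess_mul {h : EuclideanSpace ℂ (Fin n) → ℂ} (hh : AnalyticAt ℂ h p)
    {m : ℕ} (W : Matrix (Fin n) (Fin m) ℂ) :
    W.transpose * hess h p * W = Matrix.of fun i j =>
      fderiv ℂ (fderiv ℂ h) p (WithLp.toLp 2 (W.col i)) (WithLp.toLp 2 (W.col j)) := by
  have hv : ∀ v : EuclideanSpace ℂ (Fin n), v = ∑ j, v j • EuclideanSpace.single j (1 : ℂ) := by
    intro v
    ext i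
    simp [Finset.sum_apply, Pi.single_apply]
  ext i j
  rw [Matrix.of_apply, hv (WithLp.toLp 2 (W.col i)), hv (WithLp.toLp 2 (W.col j))]
  simp only [map_sum, map_smul, sum_apply, smul_apply, smul_eq_mul, ← hess_apply hh,
    Matrix.mul_apply, Matrix.transpose_apply, Matrix.col_apply, Finset.sum_mul, Finset.mul_sum]
  refine Finset.sum_congr rfl fun a _ => ?_
  refine Finset.sum_congr rfl fun b _ => ?_
  ring

end WeightedHomogeneous

/-! ### Tangent spaces of the sphere -/

section TangentSpaces

variable {n : ℕ}

/-- The real hyperplane `{v | Re ⟨v, p⟩ = 0}`, the tangent space at `p` of the sphere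
through `p`. -/
def realHyperplane (p : EuclideanSpace ℂ (Fin n)) : Submodule ℝ (EuclideanSpace ℂ (Fin n)) :=
  LinearMap.ker (Complex.reLm ∘ₗ ((innerSL ℂ p).toLinearMap.restrictScalars ℝ))

/-- The complex hyperplane `{v | ⟨v, p⟩ = 0}`, as a real vector space. -/
def complexHyperplane (p : EuclideanSpace ℂ (Fin n)) : Submodule ℝ (EuclideanSpace ℂ (Fin n)) :=
  (LinearMap.ker (innerSL ℂ p).toLinearMap).restrictScalars ℝ

theorem mem_realHyperplane {p v : EuclideanSpace ℂ (Fin n)} :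
    v ∈ realHyperplane p ↔ (inner ℂ p v).re = 0 := Iff.rfl

theorem mem_complexHyperplane {p v : EuclideanSpace ℂ (Fin n)} :
    v ∈ complexHyperplane p ↔ inner ℂ p v = 0 := Iff.rfl

theorem finrank_realHyperplane {p : EuclideanSpace ℂ (Fin n)} (hp : p ≠ 0) :
    Module.finrank ℝ (realHyperplane p) = 2 * n - 1 := by
  have h0 : (Complex.reLm ∘ₗ ((innerSL ℂ p).toLinearMap.restrictScalars ℝ)) ≠ 0 := by
    intro h
    have := LinearMap.congr_fun h p
    simp only [LinearMap.comp_apply, LinearMap.restrictScalars_apply, LinearMap.zero_apply,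
      ContinuousLinearMap.coe_coe, innerSL_apply_apply, Complex.reLm_coe] at this
    exact hp (inner_self_eq_zero.1 (Complex.ext this (inner_self_im (𝕜 := ℂ) p)))
  have := Module.Dual.finrank_ker_add_one_of_ne_zero (f := (Complex.reLm ∘ₗ
    ((innerSL ℂ p).toLinearMap.restrictScalars ℝ) : Module.Dual ℝ (EuclideanSpace ℂ (Fin n)))) h0
  rw [finrank_real_of_complex, finrank_euclideanSpace_fin] at this
  exact Nat.eq_sub_of_add_eq this

theorem finrank_complexHyperplane {p : EuclideanSpace ℂ (Fin n)} (hp : p ≠ 0) :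
    Module.finrank ℝ (complexHyperplane p) = 2 * n - 2 := by
  have h0 : (innerSL ℂ p).toLinearMap ≠ 0 := by
    intro h
    have := LinearMap.congr_fun h p
    simp at this
    exact hp this
  have := Module.Dual.finrank_ker_add_one_of_ne_zero
    (f := ((innerSL ℂ p).toLinearMap : Module.Dual ℂ (EuclideanSpace ℂ (Fin n)))) h0
  rw [finrank_euclideanSpace_fin] at this
  have h2 : Module.finrank ℝ (complexHyperplane p) =
      2 * Module.finrank ℂ (LinearMap.ker (innerSL ℂ p).toLinearMap) :=
    finrank_real_of_complex (LinearMap.ker (innerSL ℂ p).toLinearMap)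
  rw [h2]
  omega

/-- The differential of a local parametrization of an open subset of a sphere maps onto the tangent
space of the sphere. -/
theorem IsLocalParam.range_fderiv {k : ℕ} {ε : ℝ} {M : Set (EuclideanSpace ℂ (Fin n))}
    (hM : M ⊆ Metric.sphere 0 ε) (hk : k + 1 = 2 * n - 1)
    {φ : OpenPartialHomeomorph (ℝ × (Fin k → ℝ)) M} (hφ : IsLocalParam φ)
    {x : ℝ × (Fin k → ℝ)} (hx : x ∈ φ.source) (hx0 : (φ x : EuclideanSpace ℂ (Fin n)) ≠ 0) :
    LinearMap.range (fderiv ℝ (fun y => (φ y : EuclideanSpace ℂ (Fin n))) x).toLinearMap =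
      realHyperplane (φ x : EuclideanSpace ℂ (Fin n)) := by
  refine Submodule.eq_of_le_of_finrank_eq ?_ ?_
  · rintro _ ⟨v, rfl⟩
    have hd := ((hφ.contDiffOn.contDiffAt (φ.open_source.mem_nhds hx)).differentiableAt
      (by simp)).hasFDerivAt
    have h1 := hd.inner ℂ hd
    have h2 : HasFDerivAt (fun y => inner ℂ (φ y : EuclideanSpace ℂ (Fin n)) (φ y))
        (0 : (ℝ × (Fin k → ℝ)) →L[ℝ] ℂ) x := by
      have hc : (fun y => inner ℂ (φ y : EuclideanSpace ℂ (Fin n)) (φ y)) =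
          fun _ => ((ε : ℂ) ^ 2) := by
        ext1 y
        have : ‖(φ y : EuclideanSpace ℂ (Fin n))‖ = ε := by simpa using hM (φ y).2
        rw [inner_self_eq_norm_sq_to_K, this]
        rfl
      rw [hc]
      exact hasFDerivAt_const _ _
    have h3 := DFunLike.congr_fun (h1.unique h2) v
    rw [mem_realHyperplane]
    simp only [ContinuousLinearMap.comp_apply, ContinuousLinearMap.prod_apply,
      fderivInnerCLM_apply, zero_apply] at h3
    have h4 := congrArg Complex.re h3
    rw [Complex.add_re, ← inner_conj_symm (𝕜 := ℂ) _ (φ x : EuclideanSpace ℂ (Fin n)),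
      Complex.conj_re, Complex.zero_re] at h4
    exact add_self_eq_zero.1 h4
  · rw [finrank_realHyperplane hx0, LinearMap.finrank_range_of_inj (hφ.immersion x hx)]
    simp only [Module.finrank_prod, Module.finrank_self, Module.finrank_fin_fun]
    omega

end TangentSpaces

/-! ### Angular coordinates on the torus -/

section Torus

/-- Angular coordinates on the torus near `(u₀, v₀)`, sheared by `s`: the arguments `θ` of `u / u₀`
and `η` of `v / v₀` give the coordinates `(θ, η - s θ)`. -/
def torusAngles (s : ℝ) (q₀ q : ℂ × ℂ) : ℝ × ℝ :=
  ((Complex.log (q.1 / q₀.1)).im, (Complex.log (q.2 / q₀.2)).im - s * (Complex.log (q.1 / q₀.1)).im)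

/-- The parametrization `(t, y) ↦ (u₀ exp (i t), v₀ exp (i (s t + y)))` of the torus, inverse to
`torusAngles` near the origin. -/
def torusParam (s : ℝ) (q₀ : ℂ × ℂ) (x : ℝ × ℝ) : ℂ × ℂ :=
  (q₀.1 * Complex.exp (x.1 * Complex.I),
    q₀.2 * Complex.exp ((s * x.1 + x.2 : ℝ) * Complex.I))

variable {s : ℝ} {q₀ : ℂ × ℂ}

theorem contDiff_torusParam : ContDiff ℝ ∞ (torusParam s q₀) := by
  have hof : ContDiff ℝ ∞ (fun r : ℝ => (r : ℂ)) := Complex.ofRealCLM.contDiff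
  refine ContDiff.prodMk ?_ ?_
  · exact contDiff_const.mul ((hof.comp contDiff_fst).mul contDiff_const).cexp
  · exact contDiff_const.mul ((hof.comp
      ((contDiff_const.mul contDiff_fst).add contDiff_snd)).mul contDiff_const).cexp

theorem torusParam_mem_torus (hq₀ : q₀ ∈ torus) (x : ℝ × ℝ) : torusParam s q₀ x ∈ torus := by
  obtain ⟨h1, h2⟩ := hq₀
  simp only [mem_sphere_zero_iff_norm] at h1 h2
  simp only [torus, torusParam, Set.mem_prod, mem_sphere_zero_iff_norm, norm_mul,
    Complex.norm_exp_ofReal_mul_I, h1, h2]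
  norm_num

theorem differentiableAt_torusAngles (h1 : q₀.1 ≠ 0) (h2 : q₀.2 ≠ 0) :
    DifferentiableAt ℝ (torusAngles s q₀) q₀ := by
  have hlog : ∀ z : ℂ, z ≠ 0 → DifferentiableAt ℝ (fun y => (Complex.log (y / z)).im) z := by
    intro z hz
    have hd : DifferentiableAt ℝ (fun y : ℂ => Complex.log (y / z)) z :=
      ((differentiableAt_id.div_const z).clog (by simp [hz])).restrictScalars ℝ
    exact Complex.imCLM.differentiableAt.comp z hd
  have ha : DifferentiableAt ℝ (fun q : ℂ × ℂ => (Complex.log (q.1 / q₀.1)).im) q₀ :=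
    (hlog _ h1).comp q₀ differentiableAt_fst
  have hb : DifferentiableAt ℝ (fun q : ℂ × ℂ => (Complex.log (q.2 / q₀.2)).im) q₀ :=
    (hlog _ h2).comp q₀ differentiableAt_snd
  exact ha.prodMk (hb.sub (ha.const_mul s))

theorem mul_exp_log_im {u₀ u : ℂ} (h0 : ‖u₀‖ = 1) (h : ‖u‖ = 1) :
    u₀ * Complex.exp ((Complex.log (u / u₀)).im * Complex.I) = u := by
  have hu₀ : u₀ ≠ 0 := norm_ne_zero_iff.1 (by rw [h0]; exact one_ne_zero)
  have hn : ‖u / u₀‖ = 1 := by rw [norm_div, h, h0, div_one]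
  have := Complex.norm_mul_exp_arg_mul_I (u / u₀)
  rw [hn, Complex.ofReal_one, one_mul] at this
  rw [Complex.log_im, this, mul_div_cancel₀ _ hu₀]

theorem torusParam_torusAngles (hq₀ : q₀ ∈ torus) {q : ℂ × ℂ} (hq : q ∈ torus) :
    torusParam s q₀ (torusAngles s q₀ q) = q := by
  obtain ⟨h1, h2⟩ := hq₀
  obtain ⟨h3, h4⟩ := hq
  simp only [mem_sphere_zero_iff_norm] at h1 h2 h3 h4
  refine Prod.ext (mul_exp_log_im h1 h3) ?_
  simp only [torusParam, torusAngles]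
  rw [add_sub_cancel]
  exact mul_exp_log_im h2 h4

theorem torusAngles_torusParam (h1 : q₀.1 ≠ 0) (h2 : q₀.2 ≠ 0) {x : ℝ × ℝ}
    (hx : |x.1| < Real.pi) (hx' : |s * x.1 + x.2| < Real.pi) :
    torusAngles s q₀ (torusParam s q₀ x) = x := by
  have key : ∀ r : ℝ, |r| < Real.pi → (Complex.log (Complex.exp (r * Complex.I))).im = r := by
    intro r hr
    rw [Complex.log_exp] <;> simp [(abs_lt.1 hr).1, (abs_lt.1 hr).2.le]
  simp only [torusAngles, torusParam, mul_div_cancel_left₀ _ h1, mul_div_cancel_left₀ _ h2,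
    key _ hx, key _ hx']
  exact Prod.ext rfl (by simp)

theorem fderiv_torusParam_injective (h1 : q₀.1 ≠ 0) (h2 : q₀.2 ≠ 0) (x : ℝ × ℝ) :
    Function.Injective (fderiv ℝ (torusParam s q₀) x) := by
  have hof : HasFDerivAt (fun r : ℝ × ℝ => (r.1 : ℂ)) _ x :=
    Complex.ofRealCLM.hasFDerivAt.comp x hasFDerivAt_fst
  have hof2 : HasFDerivAt (fun r : ℝ × ℝ => ((s * r.1 + r.2 : ℝ) : ℂ)) _ x :=
    Complex.ofRealCLM.hasFDerivAt.comp x ((hasFDerivAt_fst.const_mul s).add hasFDerivAt_snd)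
  have hd : HasFDerivAt (torusParam s q₀) _ x :=
    ((hof.mul_const Complex.I).cexp.const_mul q₀.1).prodMk
      ((hof2.mul_const Complex.I).cexp.const_mul q₀.2)
  rw [hd.fderiv, injective_iff_map_eq_zero]
  rintro ⟨a, b⟩ hab
  have ha := congrArg Prod.fst hab
  have hb := congrArg Prod.snd hab
  simp [h1] at ha
  subst ha
  simp [h2] at hb
  simp [hb]

/-- The chart of the torus given by `torusParam`. -/
theorem exists_torus_chart (s : ℝ) (q₀ : torus) :
    ∃ ψ : OpenPartialHomeomorph (ℝ × ℝ) torus, IsLocalParam ψ ∧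
      (∀ x, (ψ x : ℂ × ℂ) = torusParam s q₀ x) ∧
      ψ.source = {x | |x.1| < Real.pi ∧ |s * x.1 + x.2| < Real.pi} := by
  have hq₀ := q₀.2
  obtain ⟨hn1, hn2⟩ := q₀.2
  simp only [mem_sphere_zero_iff_norm] at hn1 hn2
  have h1 : (q₀ : ℂ × ℂ).1 ≠ 0 := norm_ne_zero_iff.1 (by rw [hn1]; exact one_ne_zero)
  have h2 : (q₀ : ℂ × ℂ).2 ≠ 0 := norm_ne_zero_iff.1 (by rw [hn2]; exact one_ne_zero)
  have hcont : ∀ q : torus, (q : ℂ × ℂ).1 / (q₀ : ℂ × ℂ).1 ∈ Complex.slitPlane →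
      (q : ℂ × ℂ).2 / (q₀ : ℂ × ℂ).2 ∈ Complex.slitPlane →
      ContinuousAt (fun q : torus => torusAngles s q₀ q) q := by
    intro q hq1 hq2
    have hc1 : ContinuousAt
        (fun q : torus => (Complex.log ((q : ℂ × ℂ).1 / (q₀ : ℂ × ℂ).1)).im) q :=
      Complex.continuous_im.continuousAt.comp
        (ContinuousAt.clog (by fun_prop (disch := exact h1)) hq1)
    have hc2 : ContinuousAt
        (fun q : torus => (Complex.log ((q : ℂ × ℂ).2 / (q₀ : ℂ × ℂ).2)).im) q :=
      Complex.continuous_im.continuousAt.comp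
        (ContinuousAt.clog (by fun_prop (disch := exact h2)) hq2)
    exact hc1.prodMk (hc2.sub (continuousAt_const.mul hc1))
  have hslit : ∀ r : ℝ, |r| < Real.pi → Complex.exp (r * Complex.I) ∈ Complex.slitPlane := by
    intro r hr
    rw [Complex.mem_slitPlane_iff_arg]
    refine ⟨?_, Complex.exp_ne_zero _⟩
    rw [Complex.arg_exp_mul_I, (toIocMod_eq_self _).2]
    · exact (abs_lt.1 hr).2.ne
    · constructor <;> linarith [(abs_lt.1 hr).1, (abs_lt.1 hr).2]
  have hangle : ∀ z : ℂ, z ∈ Complex.slitPlane → |(Complex.log z).im| < Real.pi := by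
    intro z hz
    rw [Complex.log_im, abs_lt]
    exact ⟨Complex.neg_pi_lt_arg z, (Complex.arg_le_pi z).lt_of_ne
      (Complex.mem_slitPlane_iff_arg.1 hz).1⟩
  let ψ : OpenPartialHomeomorph (ℝ × ℝ) torus :=
    { toFun := fun x => ⟨torusParam s q₀ x, torusParam_mem_torus hq₀ x⟩
      invFun := fun q => torusAngles s q₀ q
      source := {x | |x.1| < Real.pi ∧ |s * x.1 + x.2| < Real.pi}
      target := {q | (q : ℂ × ℂ).1 / (q₀ : ℂ × ℂ).1 ∈ Complex.slitPlane ∧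
        (q : ℂ × ℂ).2 / (q₀ : ℂ × ℂ).2 ∈ Complex.slitPlane}
      map_source' := fun x hx => by
        simp only [torusParam, Set.mem_ofPred_eq, mul_div_cancel_left₀ _ h1,
          mul_div_cancel_left₀ _ h2]
        exact ⟨hslit _ hx.1, hslit _ hx.2⟩
      map_target' := fun q hq => by
        refine ⟨hangle _ hq.1, ?_⟩
        simp only [torusAngles, add_sub_cancel]
        exact hangle _ hq.2
      left_inv' := fun x hx => torusAngles_torusParam h1 h2 hx.1 hx.2
      right_inv' := fun q _ => Subtype.ext (torusParam_torusAngles hq₀ q.2)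
      open_source := (isOpen_lt (f := fun x : ℝ × ℝ => |x.1|) (by fun_prop)
        continuous_const).inter (isOpen_lt (f := fun x : ℝ × ℝ => |s * x.1 + x.2|) (by fun_prop)
          continuous_const)
      open_target := (Complex.isOpen_slitPlane.preimage (by fun_prop)).inter
        (Complex.isOpen_slitPlane.preimage (by fun_prop))
      continuousOn_toFun :=
        (Continuous.subtype_mk contDiff_torusParam.continuous _).continuousOn
      continuousOn_invFun := fun q hq => (hcont q hq.1 hq.2).continuousWithinAt }
  exact ⟨ψ, ⟨contDiff_torusParam.contDiffOn, fun x _ => fderiv_torusParam_injective h1 h2 x⟩,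
    fun x => rfl, rfl⟩

end Torus

/-! ### Singular points -/

section SingularPoints

variable {n : ℕ} {f g : MvPolynomial (Fin n) ℂ} {w : Fin n → ℚ} {s : ℚ}
  {p : EuclideanSpace ℂ (Fin n)} {l m : EuclideanSpace ℂ (Fin n) → ℂ}

/-- The holomorphic function `-i (log g - s log f)`, for branches `l` of `log f` and `m` of
`log g`. Its real part is `arg g - s arg f`. -/
def shearedLog (s : ℚ) (l m : EuclideanSpace ℂ (Fin n) → ℂ) (z : EuclideanSpace ℂ (Fin n)) : ℂ :=
  -Complex.I * (m z - (s : ℂ) * l z)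

/-- The pair of phases `(f / |f|, g / |g|)`, as a map to `ℂ × ℂ`. -/
def phases (f g : MvPolynomial (Fin n) ℂ) (z : EuclideanSpace ℂ (Fin n)) : ℂ × ℂ :=
  (polyVal f z / ‖polyVal f z‖, polyVal g z / ‖polyVal g z‖)

theorem shearedLog_re (z : EuclideanSpace ℂ (Fin n)) :
    (shearedLog s l m z).re = (m z).im - s * (l z).im := by
  simp [shearedLog]

theorem analyticAt_shearedLog (hl : AnalyticAt ℂ l p) (hm : AnalyticAt ℂ m p) :
    AnalyticAt ℂ (shearedLog s l m) p :=
  analyticAt_const.mul (hm.sub (analyticAt_const.mul hl))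

theorem fderiv_shearedLog_apply (hl : AnalyticAt ℂ l p) (hm : AnalyticAt ℂ m p)
    (v : EuclideanSpace ℂ (Fin n)) :
    fderiv ℂ (shearedLog s l m) p v = -Complex.I * (fderiv ℂ m p v - s * fderiv ℂ l p v) := by
  have h : HasFDerivAt (shearedLog s l m) _ p :=
    (hm.differentiableAt.hasFDerivAt.sub
      (hl.differentiableAt.hasFDerivAt.const_mul (s : ℂ))).const_mul (-Complex.I)
  rw [h.fderiv]
  simp

theorem fderiv_weightedEuler_rescaled (hs : 0 < s) (hg : HasWeights g (fun j => s * w j))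
    (hm : IsLogBranch g p m) : fderiv ℂ m p (weightedEuler w p) = s := by
  rw [← weightedEuler_rescale hs, map_smul, hm.fderiv_weightedEuler hg, smul_eq_mul, mul_one]

theorem fderiv_shearedLog_weightedEuler (hs : 0 < s) (hf : HasWeights f w)
    (hg : HasWeights g (fun j => s * w j)) (hl : IsLogBranch f p l) (hm : IsLogBranch g p m) :
    fderiv ℂ (shearedLog s l m) p (weightedEuler w p) = 0 := by
  rw [fderiv_shearedLog_apply hl.analyticAt hm.analyticAt,
    fderiv_weightedEuler_rescaled hs hg hm, hl.fderiv_weightedEuler hf, mul_one, sub_self, mul_zero]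

theorem eventually_phases_eq (hl : IsLogBranch f p l) (hm : IsLogBranch g p m) :
    ∀ᶠ z in 𝓝 p, phases f g z =
      (Complex.exp ((l z).im * Complex.I), Complex.exp ((m z).im * Complex.I)) := by
  filter_upwards [hl.polyVal_div_norm, hm.polyVal_div_norm] with z h1 h2
  simp only [phases, h1, h2]

/-- In the sheared angular coordinates of the torus at `Φ(p)`, the map `Φ` is
`(arg f, Re h)` up to constants, where `h` is the function `shearedLog`. -/
theorem eventually_torusAngles_phases (hl : IsLogBranch f p l) (hm : IsLogBranch g p m) :
    ∀ᶠ z in 𝓝 p, torusAngles s (phases f g p) (phases f g z) =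
      ((l z).im - (l p).im, (shearedLog s l m z).re - (shearedLog s l m p).re) := by
  have hsmall : ∀ k : EuclideanSpace ℂ (Fin n) → ℂ, AnalyticAt ℂ k p →
      ∀ᶠ z in 𝓝 p, |(k z).im - (k p).im| < Real.pi := by
    intro k hk
    have hc : ContinuousAt (fun z => |(k z).im - (k p).im|) p :=
      ((Complex.continuous_im.continuousAt.comp hk.continuousAt).sub continuousAt_const).abs
    exact hc.eventually_lt continuousAt_const (by simpa using Real.pi_pos)
  have hlog : ∀ a b : ℝ, |a - b| < Real.pi →
      (Complex.log (Complex.exp (a * Complex.I) / Complex.exp (b * Complex.I))).im = a - b := by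
    intro a b hab
    rw [← Complex.exp_sub, ← sub_mul, ← Complex.ofReal_sub, Complex.log_exp] <;>
      simp only [Complex.im_ofReal_mul, Complex.I_im, mul_one]
    · exact (abs_lt.1 hab).1
    · exact (abs_lt.1 hab).2.le
  filter_upwards [eventually_phases_eq hl hm, hsmall l hl.analyticAt, hsmall m hm.analyticAt]
    with z hz h1 h2
  rw [torusAngles, hz, (eventually_phases_eq hl hm).self_of_nhds]
  simp only [hlog _ _ h1, hlog _ _ h2, shearedLog_re]
  exact Prod.ext rfl (by ring)

/-- The differential at `p` of the map `Φ` in the coordinates of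
`eventually_torusAngles_phases`, along a map with differential `A`. -/
theorem hasFDerivAt_torusAngles_phases (hl : IsLogBranch f p l) (hm : IsLogBranch g p m)
    {H : Type*} [NormedAddCommGroup H] [NormedSpace ℝ H] {γ : H → EuclideanSpace ℂ (Fin n)} {x : H}
    {A : H →L[ℝ] EuclideanSpace ℂ (Fin n)} (hγ : HasFDerivAt γ A x) (hγx : γ x = p) :
    HasFDerivAt (fun y => torusAngles s (phases f g p) (phases f g (γ y)))
      ((Complex.imCLM ∘L ((fderiv ℂ l p).restrictScalars ℝ ∘L A)).prod
        (Complex.reCLM ∘L ((fderiv ℂ (shearedLog s l m) p).restrictScalars ℝ ∘L A))) x := by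
  have hcomp : ∀ k : EuclideanSpace ℂ (Fin n) → ℂ, AnalyticAt ℂ k p →
      HasFDerivAt (fun y => k (γ y)) ((fderiv ℂ k p).restrictScalars ℝ ∘L A) x := by
    intro k hk
    have h1 : HasFDerivAt k ((fderiv ℂ k p).restrictScalars ℝ) (γ x) := by
      rw [hγx]
      exact hk.differentiableAt.hasFDerivAt.restrictScalars ℝ
    exact h1.comp x hγ
  have h1 : HasFDerivAt (fun y => (l (γ y)).im - (l p).im) _ x :=
    (Complex.imCLM.hasFDerivAt.comp x (hcomp l hl.analyticAt)).sub_const _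
  have h2 : HasFDerivAt (fun y => (shearedLog s l m (γ y)).re - (shearedLog s l m p).re) _ x :=
    (Complex.reCLM.hasFDerivAt.comp x
      (hcomp _ (analyticAt_shearedLog hl.analyticAt hm.analyticAt))).sub_const _
  have hcont : Filter.Tendsto γ (𝓝 x) (𝓝 p) := by
    have := hγ.continuousAt.tendsto
    rwa [hγx] at this
  exact (h1.prodMk h2).congr_of_eventuallyEq
    (hcont.eventually (eventually_torusAngles_phases hl hm))

theorem source_subset_sphere {ε : ℝ} : source f g ε ⊆ Metric.sphere 0 ε := Set.sdiff_subset

theorem ne_zero_of_mem_source {ε : ℝ} (hε : 0 < ε) {z : EuclideanSpace ℂ (Fin n)}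
    (hz : z ∈ source f g ε) : z ≠ 0 := by
  rintro rfl
  have := hz.1
  simp at this
  exact hε.ne this

/-- At a singular point, `d(arg g) = s d(arg f)` on the tangent space of the sphere; as the
holomorphic function `-i (log g - s log f)` is also constant along the weighted Euler field, which
is transverse to the sphere, `p` is one of its critical points. -/
theorem fderiv_shearedLog_eq_zero {ε : ℝ} (hn : 2 ≤ n) (hε : 0 < ε) (hs : 0 < s)
    (hf : HasWeights f w) (hg : HasWeights g (fun j => s * w j)) {p : source f g ε}
    (hp : IsSingularPoint (2 * n - 2) (productMap f g ε) p)
    (hl : IsLogBranch f p l) (hm : IsLogBranch g p m) :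
    fderiv ℂ (shearedLog s l m) p = 0 := by
  obtain ⟨φ, hφ, hpt, hrank⟩ := hp
  have hp0 := ne_zero_of_mem_source hε p.2
  obtain ⟨c, hc0, hc⟩ := exists_inner_weightedEuler hf.pos hp0
  set x := φ.symm p
  have hxs : x ∈ φ.source := φ.map_target hpt
  have hφx : φ x = p := φ.right_inv hpt
  have hrange := hφ.range_fderiv source_subset_sphere (by omega) hxs (hφx ▸ hp0)
  rw [hφx] at hrange
  set A := fderiv ℝ (fun y => (φ y : EuclideanSpace ℂ (Fin n))) x
  have hA : HasFDerivAt (fun y => (φ y : EuclideanSpace ℂ (Fin n))) A x :=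
    ((hφ.contDiffOn.contDiffAt (φ.open_source.mem_nhds hxs)).differentiableAt
      (by simp)).hasFDerivAt
  set q₀ : torus := productMap f g ε p with hq₀
  set T := fun y => torusAngles s q₀ (phases f g (φ y : EuclideanSpace ℂ (Fin n)))
  have hT := hasFDerivAt_torusAngles_phases (s := s) hl hm hA (by rw [hφx])
  have hne := polyVal_ne_zero p
  have hΦ : (fun y => (productMap f g ε (φ y) : ℂ × ℂ)) = fun y => torusParam s q₀ (T y) := by
    ext1 y
    exact (torusParam_torusAngles q₀.2 (productMap f g ε (φ y)).2).symm
  have htp : HasFDerivAt (torusParam s q₀) (fderiv ℝ (torusParam s q₀) (T x)) (T x) :=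
    ((contDiff_torusParam.differentiable (by simp)) (T x)).hasFDerivAt
  have hinj : Function.Injective (fderiv ℝ (torusParam s q₀) (T x)) := by
    refine fderiv_torusParam_injective ?_ ?_ _
    · simp [hq₀, productMap, hne.1]
    · simp [hq₀, productMap, hne.2]
  have hcomp : HasFDerivAt (fun y => torusParam s q₀ (T y)) _ x := htp.comp x hT
  rw [hΦ, hcomp.fderiv] at hrank
  obtain ⟨d, hd⟩ := finrank_le_one_iff.1 (Nat.lt_succ_iff.1 hrank)
  have hgen : ∀ v ∈ realHyperplane (p : EuclideanSpace ℂ (Fin n)), ∃ r : ℝ,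
      fderiv ℝ (torusParam s q₀) (T x)
        ((fderiv ℂ l p v).im, (fderiv ℂ (shearedLog s l m) p v).re) = r • (d : ℂ × ℂ) := by
    intro v hv
    rw [← hrange] at hv
    obtain ⟨u, rfl⟩ := hv
    obtain ⟨r, hr⟩ := hd ⟨_, ⟨u, rfl⟩⟩
    exact ⟨r, (congrArg Subtype.val hr).symm⟩
  set e := weightedEuler w (p : EuclideanSpace ℂ (Fin n)) with he
  have hIe : Complex.I • e ∈ realHyperplane (p : EuclideanSpace ℂ (Fin n)) := by
    rw [mem_realHyperplane, inner_smul_right, hc]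
    simp
  have htan : ∀ v ∈ realHyperplane (p : EuclideanSpace ℂ (Fin n)),
      (fderiv ℂ (shearedLog s l m) p v).re = 0 := by
    intro v hv
    obtain ⟨r, hr⟩ := hgen v hv
    obtain ⟨r₀, hr₀⟩ := hgen _ hIe
    rw [map_smul, map_smul, hl.fderiv_weightedEuler hf,
      fderiv_shearedLog_weightedEuler hs hf hg hl hm] at hr₀
    simp only [smul_eq_mul, mul_one, mul_zero, Complex.I_im, Complex.zero_re] at hr₀
    have hr₀0 : r₀ ≠ 0 := by
      rintro rfl
      rw [zero_smul] at hr₀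
      have := hinj (hr₀.trans (map_zero _).symm)
      simp at this
    have heq := hinj (show fderiv ℝ (torusParam s q₀) (T x)
        (r₀ • ((fderiv ℂ l p v).im, (fderiv ℂ (shearedLog s l m) p v).re)) =
        fderiv ℝ (torusParam s q₀) (T x) (r • ((1 : ℝ), (0 : ℝ))) by
      rw [map_smul, map_smul, hr, hr₀, smul_comm])
    have := congrArg Prod.snd heq
    simpa [hr₀0] using this
  have hall : ∀ v, (fderiv ℂ (shearedLog s l m) p v).re = 0 := by
    intro v
    have hmem : v - (((inner ℂ (p : EuclideanSpace ℂ (Fin n)) v).re / c : ℝ) : ℂ) • e ∈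
        realHyperplane (p : EuclideanSpace ℂ (Fin n)) := by
      rw [mem_realHyperplane, inner_sub_right, inner_smul_right, hc, Complex.sub_re,
        ← Complex.ofReal_mul, Complex.ofReal_re, div_mul_cancel₀ _ hc0.ne', sub_self]
    have := htan _ hmem
    rw [map_sub, map_smul, he, fderiv_shearedLog_weightedEuler hs hf hg hl hm, smul_zero,
      sub_zero] at this
    exact this
  ext1 v
  refine Complex.ext (hall v) ?_
  have := hall (Complex.I • v)
  rw [map_smul] at this
  simpa using this

/-- If `p` and `i grad log f (p)` are dependent then `d(log f)` is a positive real multiple of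
`⟨·, p⟩`, the factor being determined by the Euler relation. -/
theorem exists_inner_eq_mul_fderiv (hp0 : p ≠ 0) (hf : HasWeights f w) (hl : IsLogBranch f p l)
    (hdep : ¬ LinearIndependent ℂ ![p, Complex.I • grad l p]) :
    ∃ c : ℝ, 0 < c ∧ ∀ v, inner ℂ p v = c * fderiv ℂ l p v := by
  obtain ⟨c, hc0, hc⟩ := exists_inner_weightedEuler hf.pos hp0
  refine ⟨c, hc0, fun v => ?_⟩
  rw [LinearIndependent.pair_iff' hp0] at hdep
  push Not at hdep
  obtain ⟨a, ha⟩ := hdep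
  have hgrad : grad l p = (-Complex.I * a) • p := by
    rw [mul_smul, ha, smul_smul]
    simp
  have hdl : ∀ v, fderiv ℂ l p v = (starRingEnd ℂ) (-Complex.I * a) * inner ℂ p v := fun v => by
    rw [fderiv_apply_eq_inner_grad, hgrad, inner_smul_left]
  have h1 := hdl (weightedEuler w p)
  rw [hl.fderiv_weightedEuler hf, hc] at h1
  rw [hdl v, mul_left_comm, ← mul_assoc, ← h1, one_mul]

end SingularPoints

/-! ### The Hessian at a fold point -/

section FoldNondegenerate

variable {n : ℕ} {f g : MvPolynomial (Fin n) ℂ} {w : Fin n → ℚ} {s : ℚ} {ε : ℝ}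
  {p : source f g ε} {l m : EuclideanSpace ℂ (Fin n) → ℂ}

/-- In fold coordinates, the second-order part of `Re h` in the directions of the `x`-axes is a
nonzero multiple of `∑ σᵢ xᵢ²`. Since the `x`-axes span the complex hyperplane
`{v | ⟨v, p⟩ = 0}`, the real part of the Hessian of `h` is nondegenerate there. -/
theorem nondegenerate_of_isFoldPoint (hn : 2 ≤ n) (hε : 0 < ε)
    (hl : IsLogBranch f p l) (hm : IsLogBranch g p m)
    (hcrit : fderiv ℂ (shearedLog s l m) p = 0)
    {c : ℝ} (hinner : ∀ v, inner ℂ (p : EuclideanSpace ℂ (Fin n)) v = c * fderiv ℂ l p v)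
    (hfold : IsFoldPoint (2 * n - 2) (productMap f g ε) p) :
    ∀ v ∈ complexHyperplane (p : EuclideanSpace ℂ (Fin n)),
      (∀ v' ∈ complexHyperplane (p : EuclideanSpace ℂ (Fin n)),
        (fderiv ℂ (fderiv ℂ (shearedLog s l m)) p v v').re = 0) → v = 0 := by
  obtain ⟨φ, ψ, σ, hφ, hψ, hσ, hφ0, hφp, hψ0, hψp, hnf⟩ := hfold
  have hp0 := ne_zero_of_mem_source hε p.2
  set h := shearedLog s l m with hh
  have hha : AnalyticAt ℂ h p := analyticAt_shearedLog hl.analyticAt hm.analyticAt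
  set B := fderiv ℂ (fderiv ℂ h) (p : EuclideanSpace ℂ (Fin n))
  have hBsymm : ∀ v v', B v v' = B v' v := fun v v' =>
    (hha.contDiffAt (n := ⊤)).isSymmSndFDerivAt (by simp) v v'
  set A := fderiv ℝ (fun y => (φ y : EuclideanSpace ℂ (Fin n))) 0
  have hA : HasFDerivAt (fun y => (φ y : EuclideanSpace ℂ (Fin n))) A 0 :=
    ((hφ.contDiffOn.contDiffAt (φ.open_source.mem_nhds hφ0)).differentiableAt
      (by simp)).hasFDerivAt
  have hAinj : Function.Injective A := hφ.immersion 0 hφ0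
  have hrange := hφ.range_fderiv source_subset_sphere (by omega) hφ0 (hφp ▸ hp0)
  rw [hφp] at hrange
  set q₀ : torus := productMap f g ε p with hq₀
  have hne := polyVal_ne_zero p
  have hne1 : (q₀ : ℂ × ℂ).1 ≠ 0 := by simp [hq₀, productMap, hne.1]
  have hne2 : (q₀ : ℂ × ℂ).2 ≠ 0 := by simp [hq₀, productMap, hne.2]
  -- `K` is the target chart `ψ`, read in the angular coordinates of the torus.
  let K : ℝ × ℝ → ℝ × ℝ := fun y => torusAngles s q₀ (ψ y : ℂ × ℂ)
  let DK := fderiv ℝ K 0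
  have hψd : DifferentiableAt ℝ (fun y => (ψ y : ℂ × ℂ)) 0 :=
    (hψ.contDiffOn.contDiffAt (ψ.open_source.mem_nhds hψ0)).differentiableAt (by simp)
  have hK : HasFDerivAt K DK 0 := by
    have h1 : DifferentiableAt ℝ (torusAngles s q₀) (ψ 0 : ℂ × ℂ) := by
      rw [hψp]
      exact differentiableAt_torusAngles hne1 hne2
    exact (h1.comp 0 hψd).hasFDerivAt
  have hDKinj : Function.Injective DK := by
    have hψK : (fun y => (ψ y : ℂ × ℂ)) = fun y => torusParam s q₀ (K y) := by
      ext1 y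
      exact (torusParam_torusAngles q₀.2 (ψ y).2).symm
    have hcomp : HasFDerivAt (fun y => torusParam s q₀ (K y)) _ 0 :=
      ((contDiff_torusParam.differentiable (by simp)) (K 0)).hasFDerivAt.comp 0 hK
    have := hψ.immersion 0 hψ0
    rw [hψK, hcomp.fderiv, ContinuousLinearMap.coe_comp] at this
    exact this.of_comp
  have hJ : (fun x => torusAngles s (phases f g p) (phases f g (φ x))) =ᶠ[𝓝 0]
      fun x => K (x.1, ∑ i, σ i * x.2 i ^ 2) := by
    filter_upwards [φ.open_source.mem_nhds hφ0] with x hx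
    change torusAngles s q₀ (productMap f g ε (φ x) : ℂ × ℂ) = _
    rw [(hnf x hx).2]
  have hJ1 := hasFDerivAt_torusAngles_phases (s := s) hl hm hA (by rw [hφp])
  have hJ2 : HasFDerivAt (fun x : ℝ × (Fin (2 * n - 2) → ℝ) => K (x.1, ∑ i, σ i * x.2 i ^ 2))
      (DK ∘L (ContinuousLinearMap.inl ℝ ℝ ℝ ∘L ContinuousLinearMap.fst ℝ ℝ _)) 0 := by
    have hQ : HasFDerivAt (fun x : ℝ × (Fin (2 * n - 2) → ℝ) => ∑ i, σ i * x.2 i ^ 2)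
        (0 : ℝ × (Fin (2 * n - 2) → ℝ) →L[ℝ] ℝ) 0 := by
      have : HasFDerivAt (fun x : ℝ × (Fin (2 * n - 2) → ℝ) => ∑ i, σ i * x.2 i ^ 2) _ 0 :=
        HasFDerivAt.fun_sum fun i _ =>
          (((ContinuousLinearMap.proj i ∘L ContinuousLinearMap.snd ℝ ℝ
            (Fin (2 * n - 2) → ℝ)).hasFDerivAt (x := 0)).pow 2).const_mul (σ i)
      refine this.congr_fderiv ?_
      simp
    have hpair : HasFDerivAt (fun x : ℝ × (Fin (2 * n - 2) → ℝ) => (x.1, ∑ i, σ i * x.2 i ^ 2))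
        (ContinuousLinearMap.inl ℝ ℝ ℝ ∘L ContinuousLinearMap.fst ℝ ℝ _) 0 :=
      (hasFDerivAt_fst.prodMk hQ)
    have hK' : HasFDerivAt K DK ((0 : ℝ × (Fin (2 * n - 2) → ℝ)).1,
        ∑ i, σ i * (0 : ℝ × (Fin (2 * n - 2) → ℝ)).2 i ^ 2) := by
      convert hK using 1
      simp
    exact hK'.comp (0 : ℝ × (Fin (2 * n - 2) → ℝ)) hpair
  have hDJ : ∀ u : ℝ × (Fin (2 * n - 2) → ℝ), ((fderiv ℂ l p (A u)).im, (0 : ℝ)) =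
      DK (u.1, 0) := by
    intro u
    have := DFunLike.congr_fun (hJ1.unique (hJ2.congr_of_eventuallyEq hJ)) u
    simpa [← hh, hcrit] using this
  -- The second component of `K` has zero derivative along the `t`-axis, hence nonzero derivative
  -- along the other axis.
  have hDK1 : (DK (1, 0)).2 = 0 := by
    have := hDJ (1, 0)
    rw [← this]
  set a := (DK (0, 1)).2 with ha
  have ha0 : a ≠ 0 := by
    intro h0
    have hker : DK ((DK (0, 1)).1, -(DK (1, 0)).1) = 0 := by
      have : (((DK (0, 1)).1, -(DK (1, 0)).1) : ℝ × ℝ) =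
          (DK (0, 1)).1 • ((1 : ℝ), (0 : ℝ)) + (-(DK (1, 0)).1) • ((0 : ℝ), (1 : ℝ)) := by simp
      rw [this, map_add, map_smul, map_smul]
      refine Prod.ext ?_ ?_
      · simp; ring
      · simp [hDK1, ← ha, h0]
    have hz := hDKinj (hker.trans (map_zero DK).symm)
    have hz1 : (DK (1, 0)).1 = 0 := by simpa using congrArg Prod.snd hz
    have : DK (1, 0) = DK 0 := by
      rw [map_zero]
      exact Prod.ext hz1 hDK1
    simpa using congrArg Prod.fst (hDKinj this)
  let V : (Fin (2 * n - 2) → ℝ) →ₗ[ℝ] EuclideanSpace ℂ (Fin n) :=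
    A.toLinearMap ∘ₗ LinearMap.inr ℝ ℝ _
  have hVinj : Function.Injective V := hAinj.comp LinearMap.inr_injective
  have hVrange : LinearMap.range V = complexHyperplane (p : EuclideanSpace ℂ (Fin n)) := by
    refine Submodule.eq_of_le_of_finrank_eq ?_ ?_
    · rintro _ ⟨ξ, rfl⟩
      have h1 : (inner ℂ (p : EuclideanSpace ℂ (Fin n)) (V ξ)).re = 0 := by
        rw [← mem_realHyperplane, ← hrange]
        exact ⟨_, rfl⟩
      have h2 : (inner ℂ (p : EuclideanSpace ℂ (Fin n)) (V ξ)).im = 0 := by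
        have h3 := congrArg Prod.fst (hDJ (0, ξ))
        have h4 : ((0 : ℝ), (0 : ℝ)) = 0 := rfl
        rw [h4, map_zero] at h3
        have h5 : (fderiv ℂ l p (V ξ)).im = 0 := h3
        rw [hinner, Complex.im_ofReal_mul, h5, mul_zero]
      rw [mem_complexHyperplane]
      exact Complex.ext h1 h2
    · rw [finrank_complexHyperplane hp0, LinearMap.finrank_range_of_inj hVinj,
        Module.finrank_fin_fun]
  have hquad : ∀ ξ, (B (V ξ) (V ξ)).re / 2 = a * ∑ i, σ i * ξ i ^ 2 := by
    intro ξ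
    have hline : HasDerivAt (fun t : ℝ => ((0 : ℝ), t • ξ)) ((0 : ℝ), ξ) 0 := by
      simpa using (hasDerivAt_const (0 : ℝ) (0 : ℝ)).prodMk ((hasDerivAt_id (0 : ℝ)).smul_const ξ)
    have hline0 : ((0 : ℝ), (0 : ℝ) • ξ) = 0 := by simp
    have hγ : HasDerivAt (fun t : ℝ => (φ (0, t • ξ) : EuclideanSpace ℂ (Fin n))) (V ξ) 0 := by
      have hA' : HasFDerivAt (fun y => (φ y : EuclideanSpace ℂ (Fin n))) A
          ((0 : ℝ), (0 : ℝ) • ξ) := by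
        rw [hline0]
        exact hA
      exact hA'.comp_hasDerivAt (0 : ℝ) hline
    have hlim1 := tendsto_div_sq_of_critical hha hcrit
      (γ := fun t : ℝ => (φ (0, t • ξ) : EuclideanSpace ℂ (Fin n)))
      (by rw [hline0, hφp]) hγ
    refine tendsto_nhds_unique hlim1 ?_
    set Q := ∑ i, σ i * ξ i ^ 2 with hQ
    have hKQ : HasDerivAt (fun r : ℝ => (K (0, r * Q)).2) (a * Q) 0 := by
      have h1 : HasDerivAt (fun r : ℝ => ((0 : ℝ), r * Q)) ((0 : ℝ), Q) 0 := by
        simpa using (hasDerivAt_const (0 : ℝ) (0 : ℝ)).prodMk ((hasDerivAt_id (0 : ℝ)).mul_const Q)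
      have h2 : HasDerivAt (fun r : ℝ => K (0, r * Q)) (DK (0, Q)) 0 := by
        have hK' : HasFDerivAt K DK ((0 : ℝ), (0 : ℝ) * Q) := by
          rw [zero_mul]
          exact hK
        exact hK'.comp_hasDerivAt (0 : ℝ) h1
      have h3 : DK (0, Q) = Q • DK (0, 1) := by
        rw [← map_smul]
        simp
      have h4 := (hasFDerivAt_snd (𝕜 := ℝ) (p := K (0, 0 * Q))).comp_hasDerivAt (0 : ℝ) h2
      simpa [h3, ← ha, mul_comm, Function.comp_def] using h4
    have hsq : Filter.Tendsto (fun t : ℝ => t ^ 2) (𝓝[≠] 0) (𝓝[≠] 0) := by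
      refine tendsto_nhdsWithin_iff.2 ⟨?_, ?_⟩
      · have : Continuous fun t : ℝ => t ^ 2 := by fun_prop
        simpa using (this.tendsto 0).mono_left nhdsWithin_le_nhds
      · filter_upwards [self_mem_nhdsWithin] with t ht
        exact pow_ne_zero 2 ht
    have hslope := (hasDerivAt_iff_tendsto_slope.1 hKQ).comp hsq
    refine hslope.congr' ?_
    have hev : ∀ᶠ t : ℝ in 𝓝 0, torusAngles s (phases f g p) (phases f g (φ (0, t • ξ))) =
        ((l (φ (0, t • ξ))).im - (l p).im, (h (φ (0, t • ξ))).re - (h p).re) ∧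
        torusAngles s (phases f g p) (phases f g (φ (0, t • ξ))) =
          K (0, ∑ i, σ i * (t • ξ) i ^ 2) := by
      have ht1 : Filter.Tendsto (fun t : ℝ => (φ (0, t • ξ) : EuclideanSpace ℂ (Fin n))) (𝓝 0)
          (𝓝 p) := by
        have := hγ.continuousAt.tendsto
        rwa [hline0, hφp] at this
      have ht2 : Filter.Tendsto (fun t : ℝ => ((0 : ℝ), t • ξ)) (𝓝 0) (𝓝 0) := by
        have := hline.continuousAt.tendsto
        rwa [hline0] at this
      exact (ht1.eventually (eventually_torusAngles_phases hl hm)).and (ht2.eventually hJ)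
    have hK0 : K (0, 0) = (0, 0) := by
      have h1 := hJ.self_of_nhds
      have h2 := (eventually_torusAngles_phases (s := s) hl hm).self_of_nhds
      simp only [hφp, h2, sub_self] at h1
      simpa using h1.symm
    filter_upwards [nhdsWithin_le_nhds hev] with t ht
    have hsum : ∑ i, σ i * (t • ξ) i ^ 2 = t ^ 2 * Q := by
      rw [hQ, Finset.mul_sum]
      refine Finset.sum_congr rfl fun i _ => ?_
      simp only [Pi.smul_apply, smul_eq_mul]
      ring
    have h1 := congrArg Prod.snd (ht.1.symm.trans ht.2)
    rw [hsum] at h1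
    simp only at h1
    rw [h1]
    simp [slope_def_field, hK0]
  intro v hv hrad
  obtain ⟨ξ, rfl⟩ : ∃ ξ, V ξ = v := by
    rw [← hVrange] at hv
    exact hv
  have hmemV : ∀ η, V η ∈ complexHyperplane (p : EuclideanSpace ℂ (Fin n)) := fun η => by
    rw [← hVrange]
    exact ⟨η, rfl⟩
  -- Test the radical vector `ξ` against `σ ξ`.
  let η : Fin (2 * n - 2) → ℝ := fun i => σ i * ξ i
  have hpol := hquad (ξ + η)
  simp only [map_add, add_apply, hBsymm (V η) (V ξ), Complex.add_re, hrad _ (hmemV η),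
    hrad _ (hmemV ξ)] at hpol
  have hη := hquad η
  have hξ := hquad ξ
  rw [hrad _ (hmemV ξ), zero_div] at hξ
  have hσ2 : ∀ i, σ i * σ i = 1 := fun i => by rcases hσ i with h | h <;> simp [h]
  have hexp : ∑ i, σ i * (ξ + η) i ^ 2 = ∑ i, σ i * ξ i ^ 2 + ∑ i, σ i * η i ^ 2 +
      2 * ∑ i, ξ i ^ 2 := by
    rw [Finset.mul_sum, ← Finset.sum_add_distrib, ← Finset.sum_add_distrib]
    refine Finset.sum_congr rfl fun i _ => ?_
    simp only [Pi.add_apply, η]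
    linear_combination (2 * ξ i ^ 2) * hσ2 i
  rw [hexp] at hpol
  have hzero : a * (2 * ∑ i, ξ i ^ 2) = 0 := by linarith
  have hsum0 : ∑ i, ξ i ^ 2 = 0 := by simpa [ha0] using hzero
  have hξ0 : ξ = 0 := by
    ext i
    have := (Finset.sum_eq_zero_iff_of_nonneg fun i _ => sq_nonneg (ξ i)).1 hsum0 i
      (Finset.mem_univ i)
    simpa using this
  rw [hξ0, map_zero]

end FoldNondegenerate

/-! ### Charts of submanifolds -/

section SubmanifoldCharts

variable {H E : Type*} [NormedAddCommGroup H] [NormedSpace ℝ H] [NormedAddCommGroup E]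
  [NormedSpace ℝ E]

/-- A diffeomorphism from an open subset of `ℝ × H` onto an open subset of `E` which maps the slice
`{0} × H` to `M` and the complement of the slice to the complement of `M` restricts to a local
parametrization of `M`. -/
theorem exists_isLocalParam_of_slice {M : Set E} (e : OpenPartialHomeomorph (ℝ × H) E)
    (he : ContDiffOn ℝ ∞ e e.source) (hes : ContDiffOn ℝ ∞ e.symm e.target)
    (hM : ∀ x ∈ e.source, e x ∈ M ↔ x.1 = 0) (h0 : (0 : ℝ × H) ∈ e.source) :
    ∃ φ : OpenPartialHomeomorph H M, IsLocalParam φ ∧ φ.source = {y | ((0 : ℝ), y) ∈ e.source} ∧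
      ∀ y ∈ φ.source, (φ y : E) = e (0, y) := by
  classical
  let q : M := ⟨e 0, (hM 0 h0).2 rfl⟩
  have hmem : ∀ y, ((0 : ℝ), y) ∈ e.source → e (0, y) ∈ M := fun y hy => (hM _ hy).2 rfl
  let F : H → M := fun y => if h : e (0, y) ∈ M then ⟨e (0, y), h⟩ else q
  have hF : ∀ y, ((0 : ℝ), y) ∈ e.source → (F y : E) = e (0, y) := fun y hy => by
    simp [F, hmem y hy]
  have hincl : Continuous fun y : H => ((0 : ℝ), y) := by fun_prop
  have hsymm : ∀ z : M, (z : E) ∈ e.target → e.symm z = (0, (e.symm z).2) := fun z hz => by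
    have h1 : (e.symm z).1 = 0 := by
      rw [← hM _ (e.map_target hz), e.right_inv hz]
      exact z.2
    exact Prod.ext h1 rfl
  let φ : OpenPartialHomeomorph H M :=
    { toFun := F
      invFun := fun z => (e.symm z).2
      source := {y | ((0 : ℝ), y) ∈ e.source}
      target := {z | (z : E) ∈ e.target}
      map_source' := fun y hy => by
        change (F y : E) ∈ e.target
        rw [hF y hy]
        exact e.map_source hy
      map_target' := fun z hz => by
        change ((0 : ℝ), (e.symm z).2) ∈ e.source
        rw [← hsymm z hz]
        exact e.map_target hz
      left_inv' := fun y hy => by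
        rw [hF y hy, e.left_inv hy]
      right_inv' := fun z hz => by
        refine Subtype.ext ?_
        have h1 := hsymm z hz
        rw [hF _ (by rw [← h1]; exact e.map_target hz), ← h1, e.right_inv hz]
      open_source := e.open_source.preimage hincl
      open_target := e.open_target.preimage continuous_subtype_val
      continuousOn_toFun := by
        refine Topology.IsInducing.subtypeVal.continuousOn_iff.2 ?_
        exact (e.continuousOn.comp hincl.continuousOn fun y hy => hy).congr fun y hy => hF y hy
      continuousOn_invFun := continuous_snd.comp_continuousOn
        (e.symm.continuousOn.comp continuous_subtype_val.continuousOn fun z hz => hz) }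
  have hcd : ∀ y ∈ φ.source, ContDiffAt ℝ ∞ e ((0 : ℝ), y) := fun y hy =>
    he.contDiffAt (e.open_source.mem_nhds hy)
  refine ⟨φ, ⟨?_, fun y hy => ?_⟩, rfl, hF⟩
  · exact (he.comp (contDiff_const.prodMk contDiff_id).contDiffOn fun y hy => hy).congr
      fun y hy => hF y hy
  · have hev : (fun y => (φ y : E)) =ᶠ[𝓝 y] fun y => e (0, y) := by
      filter_upwards [φ.open_source.mem_nhds hy] with y' hy' using hF y' hy'
    have hd : HasFDerivAt (fun y => e ((0 : ℝ), y)) (fderiv ℝ e (0, y) ∘L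
        ContinuousLinearMap.inr ℝ ℝ H) y :=
      ((hcd y hy).differentiableAt (by simp)).hasFDerivAt.comp y
        (hasFDerivAt_prodMk_right (𝕜 := ℝ) (0 : ℝ) y)
    rw [hev.fderiv_eq, hd.fderiv]
    have hs : HasFDerivAt e.symm (fderiv ℝ e.symm (e (0, y))) (e (0, y)) :=
      ((hes.contDiffAt (e.open_target.mem_nhds (e.map_source hy))).differentiableAt
        (by simp)).hasFDerivAt
    have hid : (fun y => (e.symm (e ((0 : ℝ), y))).2) =ᶠ[𝓝 y] fun y => y := by
      filter_upwards [φ.open_source.mem_nhds hy] with y' hy'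
      have hy'' : ((0 : ℝ), y') ∈ e.source := hy'
      rw [e.left_inv hy'']
    have hcomp : HasFDerivAt (fun y => (e.symm (e ((0 : ℝ), y))).2) _ y :=
      (hasFDerivAt_snd (𝕜 := ℝ)).comp y (hs.comp y hd)
    have h1 := hcomp.unique ((hasFDerivAt_id y).congr_of_eventuallyEq hid)
    refine Function.LeftInverse.injective (g := fun u => (fderiv ℝ e.symm (e (0, y)) u).2)
      fun v => ?_
    have := DFunLike.congr_fun h1 v
    simpa using this

end SubmanifoldCharts

/-! ### Slices of the sphere -/

section SphereSlice

variable {E V : Type*} [NormedAddCommGroup E] [InnerProductSpace ℂ E] [NormedAddCommGroup V]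
  [NormedSpace ℝ V] {p : E} {L : V →L[ℝ] E}

/-- The radial projection to the sphere through `p` of the affine space `p + L V`. -/
def sphereSlice (p : E) (L : V →L[ℝ] E) (x : V) : E :=
  (‖p‖ / ‖p + L x‖) • (p + L x)

theorem norm_le_norm_add_of_inner_eq_zero (hL : ∀ x, inner ℂ p (L x) = 0) (x : V) :
    ‖p‖ ≤ ‖p + L x‖ := by
  have h := norm_add_sq_eq_norm_sq_add_norm_sq_of_inner_eq_zero p (L x) (hL x)
  nlinarith [norm_nonneg p, norm_nonneg (p + L x), norm_nonneg (L x)]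

theorem add_ne_zero_of_inner_eq_zero (hp : p ≠ 0) (hL : ∀ x, inner ℂ p (L x) = 0) (x : V) :
    p + L x ≠ 0 :=
  norm_pos_iff.1 ((norm_pos_iff.2 hp).trans_le (norm_le_norm_add_of_inner_eq_zero hL x))

theorem sphereSlice_zero (hp : p ≠ 0) : sphereSlice p L 0 = p := by
  simp [sphereSlice, hp]

theorem norm_sphereSlice (hp : p ≠ 0) (hL : ∀ x, inner ℂ p (L x) = 0) (x : V) :
    ‖sphereSlice p L x‖ = ‖p‖ := by
  have := norm_ne_zero_iff.2 (add_ne_zero_of_inner_eq_zero hp hL x)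
  rw [sphereSlice, norm_smul, norm_div, norm_norm, norm_norm, div_mul_cancel₀ _ this]

theorem contDiff_norm_div_norm_add (hp : p ≠ 0) (hL : ∀ x, inner ℂ p (L x) = 0) :
    ContDiff ℝ ∞ fun x => ‖p‖ / ‖p + L x‖ :=
  contDiff_const.div ((contDiff_const.add L.contDiff).norm ℂ
    (add_ne_zero_of_inner_eq_zero hp hL)) fun x =>
      norm_ne_zero_iff.2 (add_ne_zero_of_inner_eq_zero hp hL x)

theorem contDiff_sphereSlice (hp : p ≠ 0) (hL : ∀ x, inner ℂ p (L x) = 0) :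
    ContDiff ℝ ∞ (sphereSlice p L) :=
  (contDiff_norm_div_norm_add hp hL).smul (contDiff_const.add L.contDiff)

/-- The scaling factor of `sphereSlice` is maximal at `0`, so the slice is tangent to `L`. -/
theorem hasFDerivAt_sphereSlice (hp : p ≠ 0) (hL : ∀ x, inner ℂ p (L x) = 0) :
    HasFDerivAt (sphereSlice p L) L 0 := by
  have hmax : IsLocalMax (fun x => ‖p‖ / ‖p + L x‖) 0 := by
    refine Filter.Eventually.of_forall fun x => ?_
    simp only [map_zero, add_zero, div_self (norm_ne_zero_iff.2 hp)]
    exact div_le_one_of_le₀ (norm_le_norm_add_of_inner_eq_zero hL x) (norm_nonneg _)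
  have h1 : HasFDerivAt (fun x => ‖p‖ / ‖p + L x‖) (0 : V →L[ℝ] ℝ) 0 := by
    rw [← hmax.fderiv_eq_zero]
    exact ((contDiff_norm_div_norm_add hp hL).differentiable (by simp) 0).hasFDerivAt
  refine (h1.smul (L.hasFDerivAt.const_add p)).congr_fderiv ?_
  ext1 v
  simp [hp]

end SphereSlice

/-! ### Construction of fold coordinates -/

section NondegenerateFold

variable {n : ℕ} {f g : MvPolynomial (Fin n) ℂ} {w : Fin n → ℚ} {s : ℚ}
  {l m : EuclideanSpace ℂ (Fin n) → ℂ}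

/-- A neighbourhood on which the branches of `log f` and `log g` are smooth and are logarithms of
`f` and `g`. -/
theorem exists_open_branches {p : EuclideanSpace ℂ (Fin n)} (hl : IsLogBranch f p l)
    (hm : IsLogBranch g p m) :
    ∃ U : Set (EuclideanSpace ℂ (Fin n)), IsOpen U ∧ p ∈ U ∧ ContDiffOn ℝ ∞ l U ∧
      ContDiffOn ℝ ∞ m U ∧ ∀ z ∈ U, Complex.exp (l z) = polyVal f z ∧
        Complex.exp (m z) = polyVal g z := by
  obtain ⟨U, hU, hUo, hpU⟩ := eventually_nhds_iff.1
    ((hl.analyticAt.eventually_analyticAt.and hm.analyticAt.eventually_analyticAt).and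
      (hl.exp_eq.and hm.exp_eq))
  refine ⟨U, hUo, hpU, fun z hz => ?_, fun z hz => ?_, fun z hz => (hU z hz).2⟩
  · exact ((hU z hz).1.1.contDiffAt.restrict_scalars ℝ).contDiffWithinAt
  · exact ((hU z hz).1.2.contDiffAt.restrict_scalars ℝ).contDiffWithinAt

/-- Linear coordinates on the complex hyperplane in which the real part of half the form `B` is
`∑ σᵢ xᵢ²`. -/
theorem exists_complexHyperplane_coordinates {p : EuclideanSpace ℂ (Fin n)} (hp : p ≠ 0)
    (B : EuclideanSpace ℂ (Fin n) →L[ℂ] EuclideanSpace ℂ (Fin n) →L[ℂ] ℂ)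
    (hB : ∀ v v', B v v' = B v' v)
    (hnd : ∀ v ∈ complexHyperplane p, (∀ v' ∈ complexHyperplane p, (B v v').re = 0) → v = 0) :
    ∃ (σ : Fin (2 * n - 2) → ℝ) (L : (Fin (2 * n - 2) → ℝ) →L[ℝ] EuclideanSpace ℂ (Fin n)),
      (∀ i, σ i = 1 ∨ σ i = -1) ∧ Function.Injective L ∧ (∀ x, inner ℂ p (L x) = 0) ∧
      ∀ x, (B (L x) (L x)).re / 2 = ∑ i, σ i * x i ^ 2 := by
  let Q : LinearMap.BilinForm ℝ (complexHyperplane p) :=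
    LinearMap.mk₂ ℝ (fun v v' => (B v v').re / 2)
      (fun v₁ v₂ v' => by simp; ring) (fun r v v' => by
        simp only [Submodule.coe_smul]
        rw [← Complex.coe_smul, map_smul]
        simp
        ring)
      (fun v v₁ v₂ => by simp; ring) (fun r v v' => by
        simp only [Submodule.coe_smul]
        rw [← Complex.coe_smul, map_smul]
        simp
        ring)
  obtain ⟨σ, L, hσ, hL⟩ := exists_linearEquiv_sum_sq (finrank_complexHyperplane hp) Q
    (fun v v' => by simp [Q, hB (v : EuclideanSpace ℂ (Fin n)) v']) (fun v hv => by
      refine Subtype.ext (hnd v v.2 fun v' hv' => ?_)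
      have := hv ⟨v', hv'⟩
      simpa [Q] using this)
  refine ⟨σ, LinearMap.toContinuousLinearMap ((complexHyperplane p).subtype ∘ₗ L.toLinearMap), hσ,
    ?_, fun x => (L x).2, fun x => ?_⟩
  · exact Subtype.val_injective.comp L.injective
  · exact hL x

variable {ε : ℝ} {p : source f g ε}

/-- If the Hessian is nondegenerate, the fold coordinates are built by moving the slice
`sphereSlice` of the sphere with the circle action: on the slice, `Re h` is brought to normal form
by the Morse lemma; the action shifts `arg f` by `t`, and does not change `Re h`. -/
theorem isFoldPoint_of_nondegenerate (hn : 2 ≤ n) (hε : 0 < ε) (hs : 0 < s)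
    (hf : HasWeights f w) (hg : HasWeights g (fun j => s * w j))
    (hl : IsLogBranch f p l) (hm : IsLogBranch g p m)
    (hcrit : fderiv ℂ (shearedLog s l m) p = 0)
    {c : ℝ} (hc : 0 < c)
    (hinner : ∀ v, inner ℂ (p : EuclideanSpace ℂ (Fin n)) v = c * fderiv ℂ l p v)
    (hnd : ∀ v ∈ complexHyperplane (p : EuclideanSpace ℂ (Fin n)),
      (∀ v' ∈ complexHyperplane (p : EuclideanSpace ℂ (Fin n)),
        (fderiv ℂ (fderiv ℂ (shearedLog s l m)) p v v').re = 0) → v = 0) :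
    IsFoldPoint (2 * n - 2) (productMap f g ε) p := by
  have hp0 := ne_zero_of_mem_source hε p.2
  have hpε : ‖(p : EuclideanSpace ℂ (Fin n))‖ = ε := by simpa using source_subset_sphere p.2
  set h := shearedLog s l m with hh
  have hha : AnalyticAt ℂ h p := analyticAt_shearedLog hl.analyticAt hm.analyticAt
  obtain ⟨σ, L, hσ, hLinj, hLp, hLB⟩ := exists_complexHyperplane_coordinates hp0 _
    (fun v v' => (hha.contDiffAt (n := ⊤)).isSymmSndFDerivAt (by simp) v v') hnd
  obtain ⟨U, hU, hpU, hlU, hmU, hexp⟩ := exists_open_branches hl hm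
  set z : (Fin (2 * n - 2) → ℝ) → EuclideanSpace ℂ (Fin n) := sphereSlice p L
  have hzc : ContDiff ℝ ∞ z := contDiff_sphereSlice hp0 hLp
  have hz0 : z 0 = p := sphereSlice_zero hp0
  have hzd : HasFDerivAt z L 0 := hasFDerivAt_sphereSlice hp0 hLp
  have hzn : ∀ x, ‖z x‖ = ε := fun x => (norm_sphereSlice hp0 hLp x).trans hpε
  set Ω : Set (Fin (2 * n - 2) → ℝ) := z ⁻¹' U
  have hΩ : IsOpen Ω := hU.preimage hzc.continuous
  have h0Ω : (0 : Fin (2 * n - 2) → ℝ) ∈ Ω := by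
    change z 0 ∈ U
    rwa [hz0]
  have hlΩ : ContDiffOn ℝ ∞ (fun x => (l (z x)).im) Ω :=
    Complex.imCLM.contDiff.comp_contDiffOn (hlU.comp hzc.contDiffOn fun x hx => hx)
  have hmΩ : ContDiffOn ℝ ∞ (fun x => (m (z x)).im) Ω :=
    Complex.imCLM.contDiff.comp_contDiffOn (hmU.comp hzc.contDiffOn fun x hx => hx)
  have hcompd : ∀ k : EuclideanSpace ℂ (Fin n) → ℂ, AnalyticAt ℂ k p →
      HasFDerivAt (fun x => k (z x)) ((fderiv ℂ k p).restrictScalars ℝ ∘L L) 0 := by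
    intro k hk
    have h1 : HasFDerivAt k ((fderiv ℂ k p).restrictScalars ℝ) (z 0) := by
      rw [hz0]
      exact hk.differentiableAt.hasFDerivAt.restrictScalars ℝ
    exact h1.comp 0 hzd
  -- Morse coordinates for `Re h` on the slice
  obtain ⟨e, h0e, he0, heΩ, hec, hesc, heF⟩ := exists_morse_chart hσ
    (F := fun x => (h (z x)).re - (h p).re) hΩ h0Ω
    (by
      simp only [hh, shearedLog_re]
      exact (hmΩ.sub (contDiffOn_const.mul hlΩ)).sub contDiffOn_const)
    (by rw [hz0, sub_self])
    (by
      have h1 : HasFDerivAt (fun x => (h (z x)).re - (h p).re) _ 0 :=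
        (Complex.reCLM.hasFDerivAt.comp 0 (hcompd h hha)).sub_const _
      refine h1.congr_fderiv ?_
      rw [hcrit]
      ext1 v
      simp)
    (fun ξ => by
      rw [← hLB]
      have hline : HasDerivAt (fun t : ℝ => t • ξ) ξ 0 := by
        simpa using (hasDerivAt_id (0 : ℝ)).smul_const ξ
      have hzd' : HasFDerivAt z L ((0 : ℝ) • ξ) := by rwa [zero_smul]
      have hγ : HasDerivAt (fun t : ℝ => z (t • ξ)) (L ξ) 0 :=
        HasFDerivAt.comp_hasDerivAt (l := z) (f := fun t : ℝ => t • ξ) (0 : ℝ) hzd' hline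
      exact tendsto_div_sq_of_critical hha hcrit (by rw [zero_smul, hz0]) hγ)
  -- `τ` is chosen so that `arg f` at `G (0, (t, x))` exceeds its value at `p` by exactly `t`.
  let τ : (Fin (2 * n - 2) → ℝ) → ℝ := fun x => (l (z x)).im - (l p).im
  have hτ0 : τ 0 = 0 := by simp only [τ, hz0, sub_self]
  have hτd : HasFDerivAt τ (0 : (Fin (2 * n - 2) → ℝ) →L[ℝ] ℝ) 0 := by
    have h1 : HasFDerivAt τ _ 0 :=
      (Complex.imCLM.hasFDerivAt.comp 0 (hcompd l hl.analyticAt)).sub_const _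
    refine h1.congr_fderiv ?_
    ext1 v
    have h2 := hinner (L v)
    rw [hLp] at h2
    have h3 : fderiv ℂ l p (L v) = 0 := by
      have : (c : ℂ) ≠ 0 := by exact_mod_cast hc.ne'
      simpa [this] using h2.symm
    simp [h3]
  let y : ℝ × (ℝ × (Fin (2 * n - 2) → ℝ)) → ℂ × EuclideanSpace ℂ (Fin n) :=
    fun q => (((q.2.1 - τ q.2.2 : ℝ) : ℂ) * Complex.I, z q.2.2)
  let G : ℝ × (ℝ × (Fin (2 * n - 2) → ℝ)) → EuclideanSpace ℂ (Fin n) :=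
    fun q => Real.exp q.1 • weightedFlow w (y q).1 (y q).2
  -- The norm of `G (r, (t, x))` is `exp r * ε`, so the slice `r = 0` is the sphere.
  let N : Set (ℝ × (ℝ × (Fin (2 * n - 2) → ℝ))) := {q | q.2.2 ∈ Ω}
  have hN : IsOpen N := hΩ.preimage (by fun_prop)
  have hGc : ContDiffOn ℝ ∞ G N := by
    have hx : ContDiff ℝ ∞ fun q : ℝ × (ℝ × (Fin (2 * n - 2) → ℝ)) => q.2.2 :=
      contDiff_snd.comp contDiff_snd
    have ht : ContDiff ℝ ∞ fun q : ℝ × (ℝ × (Fin (2 * n - 2) → ℝ)) => q.2.1 :=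
      contDiff_fst.comp contDiff_snd
    have hτc : ContDiffOn ℝ ∞ (fun q : ℝ × (ℝ × (Fin (2 * n - 2) → ℝ)) => τ q.2.2) N :=
      (hlΩ.sub contDiffOn_const).comp hx.contDiffOn fun q hq => hq
    have hyc : ContDiffOn ℝ ∞ y N :=
      ((Complex.ofRealCLM.contDiff.comp_contDiffOn (ht.contDiffOn.sub hτc)).mul
        contDiffOn_const).prodMk (hzc.comp hx).contDiffOn
    exact (Real.contDiff_exp.comp contDiff_fst).contDiffOn.smul
      ((contDiff_weightedFlow.restrict_scalars ℝ).comp_contDiffOn hyc)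
  let D : ℝ × (ℝ × (Fin (2 * n - 2) → ℝ)) →L[ℝ] EuclideanSpace ℂ (Fin n) :=
    (ContinuousLinearMap.toSpanSingleton ℝ (p : EuclideanSpace ℂ (Fin n))).coprod
      ((ContinuousLinearMap.toSpanSingleton ℝ
        (Complex.I • weightedEuler w (p : EuclideanSpace ℂ (Fin n)))).coprod L)
  have hGd : HasFDerivAt G D 0 := by
    have hx : HasFDerivAt (fun q : ℝ × (ℝ × (Fin (2 * n - 2) → ℝ)) => q.2.2)
        (ContinuousLinearMap.snd ℝ ℝ _ ∘L ContinuousLinearMap.snd ℝ ℝ _) 0 :=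
      HasFDerivAt.comp 0 (hasFDerivAt_snd (𝕜 := ℝ) (p := (0 : ℝ × (Fin (2 * n - 2) → ℝ))))
        hasFDerivAt_snd
    have ht : HasFDerivAt (fun q : ℝ × (ℝ × (Fin (2 * n - 2) → ℝ)) => q.2.1)
        (ContinuousLinearMap.fst ℝ ℝ _ ∘L ContinuousLinearMap.snd ℝ ℝ _) 0 :=
      HasFDerivAt.comp 0 (hasFDerivAt_fst (𝕜 := ℝ) (p := (0 : ℝ × (Fin (2 * n - 2) → ℝ))))
        hasFDerivAt_snd
    have hτq : HasFDerivAt (fun q : ℝ × (ℝ × (Fin (2 * n - 2) → ℝ)) => τ q.2.2) _ 0 :=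
      HasFDerivAt.comp (0 : ℝ × (ℝ × (Fin (2 * n - 2) → ℝ))) (g := τ) hτd hx
    have hzq : HasFDerivAt (fun q : ℝ × (ℝ × (Fin (2 * n - 2) → ℝ)) => z q.2.2) _ 0 :=
      HasFDerivAt.comp (0 : ℝ × (ℝ × (Fin (2 * n - 2) → ℝ))) (g := z) hzd hx
    have hy : HasFDerivAt y _ 0 :=
      ((Complex.ofRealCLM.hasFDerivAt.comp 0 (ht.sub hτq)).mul_const Complex.I).prodMk hzq
    have hy0 : y 0 = (0, (p : EuclideanSpace ℂ (Fin n))) := by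
      simp [y, hτ0, hz0]
    have hw := (hasFDerivAt_weightedFlow (w := w) (p : EuclideanSpace ℂ (Fin n))).restrictScalars ℝ
    rw [← hy0] at hw
    have hflow : HasFDerivAt (fun q => weightedFlow w (y q).1 (y q).2) _ 0 :=
      HasFDerivAt.comp (0 : ℝ × (ℝ × (Fin (2 * n - 2) → ℝ)))
        (g := fun q : ℂ × EuclideanSpace ℂ (Fin n) => weightedFlow w q.1 q.2) hw hy
    have hr : HasFDerivAt (fun q : ℝ × (ℝ × (Fin (2 * n - 2) → ℝ)) => Real.exp q.1) _ 0 :=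
      (hasFDerivAt_fst (𝕜 := ℝ) (p := (0 : ℝ × (ℝ × (Fin (2 * n - 2) → ℝ))))).exp
    refine (hr.smul hflow).congr_fderiv ?_
    refine ContinuousLinearMap.ext fun v => ?_
    simp [D, hy0, weightedFlow_zero]
    rw [← Complex.coe_smul v.2.1, smul_smul, mul_comm Complex.I]
    abel
  -- Pairing with `p`, whose product with the Euler vector is a positive real number, separates
  -- the three summands of `D`.
  have hDinj : Function.Injective D := by
    rw [injective_iff_map_eq_zero]
    rintro ⟨r, t, x⟩ hrtx
    obtain ⟨c', hc'0, hc'⟩ := exists_inner_weightedEuler hf.pos hp0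
    have h1 : (r : ℂ) • (p : EuclideanSpace ℂ (Fin n)) + ((t : ℂ) • (Complex.I •
        weightedEuler w (p : EuclideanSpace ℂ (Fin n))) + L x) = 0 := by
      simpa [D, Complex.coe_smul] using hrtx
    have h2 := congrArg (inner ℂ (p : EuclideanSpace ℂ (Fin n))) h1
    rw [inner_add_right, inner_add_right, inner_smul_right, inner_smul_right, inner_smul_right,
      hLp, hc', inner_self_eq_norm_sq_to_K, hpε, inner_zero_right] at h2
    have h2' : ((r * ε ^ 2 : ℝ) : ℂ) + ((t * c' : ℝ) : ℂ) * Complex.I = 0 := by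
      rw [← h2]
      push_cast
      simp only [Complex.coe_algebraMap]
      ring
    have hr : r = 0 := by
      have h3 := congrArg Complex.re h2'
      rw [Complex.add_re, Complex.re_ofReal_mul, Complex.ofReal_re, Complex.I_re, mul_zero,
        add_zero, Complex.zero_re] at h3
      exact (mul_eq_zero.1 h3).resolve_right (pow_ne_zero 2 hε.ne')
    have ht : t = 0 := by
      have h3 := congrArg Complex.im h2'
      rw [Complex.add_im, Complex.im_ofReal_mul, Complex.ofReal_im, Complex.I_im, mul_one,
        zero_add, Complex.zero_im] at h3
      exact (mul_eq_zero.1 h3).resolve_right hc'0.ne'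
    subst hr ht
    have hx : L x = 0 := by simpa using h1
    have hx0 : x = 0 := hLinj (hx.trans (map_zero L).symm)
    rw [hx0]
    rfl
  have hdim : Module.finrank ℝ (ℝ × (ℝ × (Fin (2 * n - 2) → ℝ))) =
      Module.finrank ℝ (EuclideanSpace ℂ (Fin n)) := by
    rw [finrank_real_of_complex, finrank_euclideanSpace_fin]
    simp only [Module.finrank_prod, Module.finrank_self, Module.finrank_fin_fun]
    omega
  let De : (ℝ × (ℝ × (Fin (2 * n - 2) → ℝ))) ≃L[ℝ] EuclideanSpace ℂ (Fin n) :=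
    (LinearEquiv.ofInjectiveOfFinrankEq D.toLinearMap hDinj hdim).toContinuousLinearEquiv
  have hGe : HasFDerivAt G (De : _ →L[ℝ] EuclideanSpace ℂ (Fin n)) 0 := hGd
  obtain ⟨e₁, h0e₁, he₁N, he₁G, he₁s⟩ := exists_openPartialHomeomorph_of_contDiffOn hN
    (show (0 : ℝ × (ℝ × (Fin (2 * n - 2) → ℝ))) ∈ N from h0Ω) hGc hGe
  -- Substitute the Morse coordinates for `x`.
  let e₂ : OpenPartialHomeomorph (ℝ × (ℝ × (Fin (2 * n - 2) → ℝ)))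
      (ℝ × (ℝ × (Fin (2 * n - 2) → ℝ))) :=
    (OpenPartialHomeomorph.refl ℝ).prod ((OpenPartialHomeomorph.refl ℝ).prod e.symm)
  obtain ⟨ψ, hψ, hψq, hψs⟩ := exists_torus_chart s (productMap f g ε p)
  let R : Set (ℝ × (ℝ × (Fin (2 * n - 2) → ℝ))) :=
    {q | (q.2.1, ∑ i, σ i * q.2.2 i ^ 2) ∈ ψ.source}
  have hR : IsOpen R := ψ.open_source.preimage (by fun_prop)
  have hψ0 : (0 : ℝ × ℝ) ∈ ψ.source := by
    rw [hψs]
    simp [Real.pi_pos]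
  let e₃ := (e₂.trans e₁).restrOpen R hR
  have hsrc : ∀ q ∈ e₃.source, q.2.2 ∈ e.target ∧ e₂ q ∈ e₁.source ∧ q ∈ R := by
    intro q hq
    obtain ⟨⟨hq1, hq2⟩, hq3⟩ := hq
    exact ⟨hq1.2.2, hq2, hq3⟩
  have he₂c : ContDiffOn ℝ ∞ e₂ e₂.source :=
    contDiffOn_fst.prodMk ((contDiff_fst.comp contDiff_snd).contDiffOn.prodMk
      (hesc.comp (contDiff_snd.comp contDiff_snd).contDiffOn fun q hq => hq.2.2))
  have he₂s : ContDiffOn ℝ ∞ e₂.symm e₂.target :=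
    contDiffOn_fst.prodMk ((contDiff_fst.comp contDiff_snd).contDiffOn.prodMk
      (hec.comp (contDiff_snd.comp contDiff_snd).contDiffOn fun q hq => hq.2.2))
  have he₃q : ∀ q, e₃ q = G (q.1, q.2.1, e.symm q.2.2) := fun q => he₁G _
  have hnorm : ∀ q, ‖G q‖ = Real.exp q.1 * ε := by
    intro q
    simp only [G, y]
    rw [norm_smul, norm_weightedFlow_mul_I, hzn, Real.norm_eq_abs, abs_of_pos (Real.exp_pos _)]
  have hfG : ∀ t x, x ∈ Ω → polyVal f (G (0, t, x)) =
      Complex.exp (((t - τ x : ℝ) : ℂ) * Complex.I + l (z x)) := by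
    intro t x hx
    simp only [G, y, Real.exp_zero, one_smul]
    rw [hf.polyVal_weightedFlow, Complex.exp_add, (hexp _ hx).1]
  have hgG : ∀ t x, x ∈ Ω → polyVal g (G (0, t, x)) =
      Complex.exp (s * (((t - τ x : ℝ) : ℂ) * Complex.I) + m (z x)) := by
    intro t x hx
    simp only [G, y, Real.exp_zero, one_smul]
    rw [← weightedFlow_rescale hs, hg.polyVal_weightedFlow, Complex.exp_add, (hexp _ hx).2]
  have he0s : e.symm 0 = 0 := by
    conv_lhs => rw [← he0]
    exact e.left_inv h0e
  have h0e₃ : (0 : ℝ × (ℝ × (Fin (2 * n - 2) → ℝ))) ∈ e₃.source := by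
    refine ⟨⟨⟨trivial, trivial, ?_⟩, ?_⟩, ?_⟩
    · change (0 : Fin (2 * n - 2) → ℝ) ∈ e.target
      rw [← he0]
      exact e.map_source h0e
    · change ((0 : ℝ), (0 : ℝ), e.symm 0) ∈ e₁.source
      rw [he0s]
      exact h0e₁
    · change ((0 : ℝ), ∑ i, σ i * (0 : ℝ) ^ 2) ∈ ψ.source
      have h1 : ∑ i, σ i * (0 : ℝ) ^ 2 = 0 := by simp
      rw [h1]
      exact hψ0
  obtain ⟨φ, hφ, hφs, hφe⟩ := exists_isLocalParam_of_slice (M := source f g ε) e₃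
    (by
      have h1 : ContDiffOn ℝ ∞ (fun q => G (e₂ q)) e₃.source :=
        hGc.comp (he₂c.mono fun q hq => hq.1.1) fun q hq => he₁N (hsrc q hq).2.1
      exact h1.congr fun q _ => he₃q q)
    (by
      have h1 : ContDiffOn ℝ ∞ (fun v => e₂.symm (e₁.symm v)) (e₂.trans e₁).target :=
        he₂s.comp (he₁s.mono fun v hv => hv.1) fun v hv => hv.2
      exact h1.mono fun v hv => hv.1)
    (fun q hq => by
      obtain ⟨hq1, hq2, hq3⟩ := hsrc q hq
      rw [he₃q]
      constructor
      · intro h1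
        have h2 : ‖G (q.1, q.2.1, e.symm q.2.2)‖ = ε := by simpa using source_subset_sphere h1
        rw [hnorm] at h2
        have h3 : Real.exp q.1 = 1 := mul_right_cancel₀ hε.ne' (h2.trans (one_mul ε).symm)
        exact Real.exp_eq_one_iff _ |>.1 h3
      · intro h1
        have hΩq : e.symm q.2.2 ∈ Ω := heΩ (e.map_target hq1)
        rw [h1]
        refine ⟨by simp [hnorm], fun h2 => ?_⟩
        have h3 := h2.2
        simp only [polyVal, map_mul] at h3
        rcases mul_eq_zero.1 h3 with h4 | h4
        · have h5 := hfG q.2.1 _ hΩq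
          exact Complex.exp_ne_zero _ (h5.symm.trans h4)
        · have h5 := hgG q.2.1 _ hΩq
          exact Complex.exp_ne_zero _ (h5.symm.trans h4))
    h0e₃
  have hφ0 : (0 : ℝ × (Fin (2 * n - 2) → ℝ)) ∈ φ.source := by
    rw [hφs]
    exact h0e₃
  refine ⟨φ, ψ, σ, hφ, hψ, hσ, hφ0, ?_, hψ0, ?_, ?_⟩
  · refine Subtype.ext ?_
    rw [hφe 0 hφ0, he₃q]
    change G (0, 0, e.symm 0) = _
    simp [he0s, G, y, hτ0, hz0, weightedFlow_zero]
  · refine Subtype.ext ?_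
    rw [hψq]
    simp [torusParam]
  · intro x hx
    have hx' : ((0 : ℝ), x) ∈ e₃.source := by
      rw [hφs] at hx
      exact hx
    obtain ⟨hx1, -, hx3⟩ := hsrc _ hx'
    refine ⟨hx3, Subtype.ext ?_⟩
    have hΩx : e.symm x.2 ∈ Ω := heΩ (e.map_target hx1)
    have hF := heF _ (e.map_target hx1)
    rw [e.right_inv hx1] at hF
    simp only [hh, shearedLog_re] at hF
    rw [hψq]
    change phases f g (φ x) = torusParam s (phases f g p) _
    rw [(eventually_phases_eq hl hm).self_of_nhds, phases, hφe x hx, he₃q]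
    simp only [hfG _ _ hΩx, hgG _ _ hΩx, exp_div_norm_exp, torusParam, ← Complex.exp_add]
    refine Prod.ext ?_ ?_
    · simp only
      congr 1
      rw [← add_mul, ← Complex.ofReal_add]
      congr 2
      simp [τ]
      ring
    · simp only
      congr 1
      rw [← add_mul, ← Complex.ofReal_add]
      congr 2
      have him : ((s : ℂ) * (((x.1 - τ (e.symm x.2) : ℝ) : ℂ) * Complex.I)).im =
          s * (x.1 - τ (e.symm x.2)) := by
        rw [← mul_assoc, ← Complex.ofReal_ratCast, ← Complex.ofReal_mul, Complex.im_ofReal_mul,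
          Complex.I_im, mul_one]
      rw [Complex.add_im, him, ← hF]
      simp only [τ]
      ring

end NondegenerateFold

end MilnorProduct

end

theorem corollary3p8 (n : ℕ) (hn : 2 ≤ n)
    (f g : MvPolynomial (Fin n) ℂ) (w : Fin n → ℚ) (s : ℚ) (hs : 0 < s)
    (hf : MilnorProduct.HasWeights f w)
    (hg : MilnorProduct.HasWeights g (fun j => s * w j))
    (ε : ℝ) (hε : 0 < ε)
    (p : MilnorProduct.source f g ε)
    (hp : MilnorProduct.IsSingularPoint (2 * n - 2) (MilnorProduct.productMap f g ε) p)
    -- arbitrary local branches of `log f` and `log g` near `p`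
    (logf logg : EuclideanSpace ℂ (Fin n) → ℂ)
    (hlogf : MilnorProduct.IsLogBranch f p logf)
    (hlogg : MilnorProduct.IsLogBranch g p logg)
    (hdep : ¬ LinearIndependent ℂ
      ![(p : EuclideanSpace ℂ (Fin n)), Complex.I • MilnorProduct.grad logf p])
    (W : Matrix (Fin n) (Fin (n - 1)) ℂ)
    -- the columns of `W` form a complex basis of `{v | ⟨v, p⟩ = 0}`
    (hWindep : LinearIndependent ℂ
      (fun k => (WithLp.toLp 2 (W.col k) : EuclideanSpace ℂ (Fin n))))
    (hWspan : (Submodule.span ℂ (Set.range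
        (fun k => (WithLp.toLp 2 (W.col k) : EuclideanSpace ℂ (Fin n)))) :
        Set (EuclideanSpace ℂ (Fin n))) =
      {v | ∑ j, v j * (starRingEnd ℂ) ((p : EuclideanSpace ℂ (Fin n)) j) = 0}) :
    MilnorProduct.IsFoldPoint (2 * n - 2) (MilnorProduct.productMap f g ε) p ↔
      (W.transpose *
        MilnorProduct.hess (fun z => -Complex.I * (logg z - (s : ℂ) * logf z)) p *
        W).det ≠ 0 := by
  have hp0 := MilnorProduct.ne_zero_of_mem_source hε p.2
  have hha := MilnorProduct.analyticAt_shearedLog (s := s) hlogf.analyticAt hlogg.analyticAt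
  have hcrit := MilnorProduct.fderiv_shearedLog_eq_zero hn hε hs hf hg hp hlogf hlogg
  obtain ⟨c, hc, hinner⟩ := MilnorProduct.exists_inner_eq_mul_fderiv hp0 hf hlogf hdep
  have hspan : ∀ v, v ∈ Submodule.span ℂ (Set.range
      (fun k => (WithLp.toLp 2 (W.col k) : EuclideanSpace ℂ (Fin n)))) ↔
      v ∈ MilnorProduct.complexHyperplane (p : EuclideanSpace ℂ (Fin n)) := by
    intro v
    rw [← SetLike.mem_coe, hWspan, MilnorProduct.mem_complexHyperplane, PiLp.inner_apply]
    rfl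
  have hdet := MilnorProduct.det_ne_zero_iff_re_nondegenerate
    (ContinuousLinearMap.coeLM ℂ ∘ₗ (fderiv ℂ (fderiv ℂ
      (MilnorProduct.shearedLog s logf logg)) (p : EuclideanSpace ℂ (Fin n))).toLinearMap)
    hWindep (fun v v' => (hha.contDiffAt (n := ⊤)).isSymmSndFDerivAt (by simp) v v')
  have hH : W.transpose * MilnorProduct.hess
      (fun z => -Complex.I * (logg z - (s : ℂ) * logf z)) p * W = _ :=
    MilnorProduct.transpose_mul_hess_mul hha W
  rw [hH]
  refine Iff.trans ?_ hdet.symm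
  simp only [hspan]
  exact ⟨MilnorProduct.nondegenerate_of_isFoldPoint hn hε hlogf hlogg hcrit hinner,
    MilnorProduct.isFoldPoint_of_nondegenerate hn hε hs hf hg hlogf hlogg hcrit hc hinner⟩
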